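/- **Setting.** Let $G$ be an $n$-dimensional real Lie group (Hausdorff, second countable) with Lie algebra $\mathfrak g$, let $dm$ be a left Haar measure on $G$, and let $\hbar\in\mathbb R\setminus\{0\}$. Let $dX$ be a Lebesgue measure on $\mathfrak g$ (any normalization is allowed) and let $dp$ be the Lebesgue measure on $\mathfrak g^*$ for which $f(X)=(2\pi)^{-n}\int_{\mathfrak g^*}\tilde f(p)e^{i\langle p,X\rangle}\,dp$ whenever $\tilde f(p)=\int_{\mathfrak g}f(X)e^{-i\langle p,X\rangle}\,dX$ and $f$ is a Schwartz function. Assume that there is an open neighbourhood $\mathcal O$ of $0$ in $\mathfrak g$ such that * $tX\in\mathcal O$ whenever $X\in\mathcal O$ and $-1\le t\le 1$; * $\exp$ restricts to a diffeomorphism of $\mathcal O$ onto an open set $\mathcal U=\exp(\mathcal O)$, and $G\setminus\mathcal U$ has measure zero; * if $S\subset\mathcal U$ has compact closure in $G$, then $\mathcal O\cap\exp^{-1}(S)$ has compact closure in $\mathfrak g$. Put $F(X)=\sqrt{|\det\lambda(\mathrm{ad}_X)|}$, where $\lambda(x)=\frac2x\sinh\frac x2=\sum_{k\ge0}\frac{x^{2k}}{4^k(2k+1)!}$.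 For $\varphi,\psi\in C_c^\infty(G)$ let $$\mathcal W(\varphi,\psi)(q,p)=\int_{\mathcal O}\overline{\varphi\bigl(q\exp(\tfrac12X)\bigr)}\,\psi\bigl(q\exp(-\tfrac12X)\bigr)\,e^{-\frac i\hbar\langle p,X\rangle}F(X)\,dX,\qquad (q,p)\in M:=G\times\mathfrak g^*,$$ be the Wigner function. Let $(\varphi,\psi)=\int_G\overline{\varphi}\,\psi\,dm$ be the scalar product of $L^2(G,dm)$. For a function $\Phi$ on $M$, the improper integral $\int_M\Phi\,dm\,dp$ is said to exist and to have the value $c$ if, for every compactly supported smooth $\chi\colon\mathfrak g^*\to\mathbb R$ with $\chi(0)=1$, the function $(q,p)\mapsto\chi(\varepsilon p)\Phi(q,p)$ is integrable for every $\varepsilon>0$ and $\int_M\chi(\varepsilon p)\Phi(q,p)\,dm(q)\,dp\to c$ as $\varepsilon\to0^+$. A linear map $\hat f\colon C_c^\infty(G)\to L^2(G,dm)$ is called the operator of a function $f$ on $M$ if, for all $\varphi,\psi\in C_c^\infty(G)$, the improper integral of $f\,\mathcal W(\varphi,\psi)$ exists and $$(\varphi,\hat f\psi)=\frac1{|2\pi\hbar|^n}\int_M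 f\,\mathcal W(\varphi,\psi)\,dm\,dp .$$ **Theorem.** (1) Let $X_1,\dots,X_n$ be a basis of $\mathfrak g$ with structure constants $[X_i,X_j]=\sum_kC^k_{ij}X_k$, and let $p_j(q,p)=\langle p,X_j\rangle$ be the corresponding fiber variables. For every $j$ the operator $\hat p_j$ of $p_j$ exists, is unique, and is given on $C_c^\infty(G)$ by $$\hat p_j=i\hbar\Bigl(L_{X_j}-\tfrac12\sum_kC^k_{jk}\Bigr),$$ where $L_{X_j}$ is the left-invariant vector field with value $X_j$ at the unit element. In particular, $\hat p_j=i\hbar L_{X_j}$ if $G$ is unimodular. (2) For every complex-valued $f\in C^\infty(G)$, regarded as the function $(q,p)\mapsto f(q)$ on $M$, the operator $\hat f$ exists, is unique, and is multiplication by $f$: $\hat f\psi=f\psi$ for $\psi\in C_c^\infty(G)$. -/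

import Mathlib

open scoped Manifold ContDiff
open MeasureTheory

noncomputable section

namespace LieQuant

/-! Throughout, `G` is a real Lie group modelled on a finite-dimensional space `E`.  In Mathlib the
Lie algebra `GroupLieAlgebra 𝓘(ℝ, E) G`, i.e. the tangent space of `G` at `1`, is by definition a
copy of the vector space `E`, without a norm of its own.  Elements and measures of the Lie algebra
are therefore written with the type `E`, and elements of its dual with the type `StrongDual ℝ E`;
brackets and left-invariant vector fields are those of `GroupLieAlgebra 𝓘(ℝ, E) G`. -/

section Group

variable {E : Type*} [NormedAddCommGroup E] [NormedSpace ℝ E]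
variable (G : Type*) [TopologicalSpace G] [ChartedSpace E G] [Group G]

instance lieGroup_minSmoothness [LieGroup 𝓘(ℝ, E) ∞ G] :
    LieGroup 𝓘(ℝ, E) (minSmoothness ℝ 3) G :=
  LieGroup.of_le (n := ∞) (by
    rw [minSmoothness_of_isRCLikeNormedField]
    exact ENat.LEInfty.out)

/-- The Lie bracket of the Lie algebra of `G`. -/
def bracket (X Y : E) : E :=
  Bracket.bracket (L := GroupLieAlgebra 𝓘(ℝ, E) G) (M := GroupLieAlgebra 𝓘(ℝ, E) G) X Y

/-- The adjoint map `ad_X = [X, ·]`. -/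
def ad [FiniteDimensional ℝ E] [LieGroup 𝓘(ℝ, E) ∞ G] (X : E) : E →L[ℝ] E :=
  LinearMap.toContinuousLinearMap
    { toFun := fun Y => bracket G X Y
      map_add' := fun Y Z => lie_add (L := GroupLieAlgebra 𝓘(ℝ, E) G)
        (M := GroupLieAlgebra 𝓘(ℝ, E) G) X Y Z
      map_smul' := fun c Y => lie_smul (R := ℝ) (L := GroupLieAlgebra 𝓘(ℝ, E) G)
        (M := GroupLieAlgebra 𝓘(ℝ, E) G) c X Y }

open Classical in
/-- The exponential map of `G`: the value at time `1` of the integral curve, starting at the unit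
element, of the left-invariant vector field `L_X` (this curve exists on all of `ℝ` and is unique
for a Hausdorff Lie group, so the default value is never used). -/
def lieExp (X : E) : G :=
  if h : ∃ γ : ℝ → G, γ 0 = 1 ∧
      IsMIntegralCurve (I := 𝓘(ℝ, E)) γ
        (mulInvariantVectorField (X : GroupLieAlgebra 𝓘(ℝ, E) G))
  then h.choose 1 else 1

variable {G} in
/-- The derivative `L_X ψ` of a function along the left-invariant vector field `L_X`. -/
def lieDeriv (X : E) (ψ : G → ℂ) (q : G) : ℂ :=
  mfderiv 𝓘(ℝ, E) 𝓘(ℝ, ℂ) ψ q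
    (mulInvariantVectorField (X : GroupLieAlgebra 𝓘(ℝ, E) G) q)

/-- The structure constants `C^k_{ij}`, given by `[X_i, X_j] = C^k_{ij} X_k`. -/
def structureConst {ι : Type*} (X : Module.Basis ι ℝ E) (k i j : ι) : ℝ :=
  X.repr (bracket G (X i) (X j)) k

/-- `F(X) = √|det λ(ad_X)|` with `λ(x) = (2/x) sinh(x/2) = ∑ x^{2n} / (4^n (2n+1)!)`. -/
def jacF [FiniteDimensional ℝ E] [LieGroup 𝓘(ℝ, E) ∞ G] (X : E) : ℝ :=
  Real.sqrt |ContinuousLinearMap.det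
    (∑' n : ℕ, ((4 : ℝ) ^ n * ((2 * n + 1).factorial : ℝ))⁻¹ • ad G X ^ (2 * n))|

variable {G} in
/-- `𝒪` is a neighbourhood of `0` in the Lie algebra which exhibits `G`, with Haar measure `m`, as a
weakly exponential group: `𝒪` is open, star-shaped and symmetric, `exp` restricts to a
diffeomorphism of `𝒪` onto `𝒰 = exp 𝒪`, the complement of `𝒰` has measure zero, and
`exp⁻¹ : 𝒰 → 𝒪` maps precompact sets onto precompact sets. -/
structure IsWeaklyExponential [MeasurableSpace G] (m : Measure G) (𝒪 : Set E) : Prop where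
  isOpen : IsOpen 𝒪
  zero_mem : 0 ∈ 𝒪
  smul_mem : ∀ X ∈ 𝒪, ∀ t : ℝ, -1 ≤ t → t ≤ 1 → t • X ∈ 𝒪
  injOn : Set.InjOn (lieExp G) 𝒪
  contMDiffOn_exp : ContMDiffOn 𝓘(ℝ, E) 𝓘(ℝ, E) ∞ (lieExp G) 𝒪
  isOpen_image : IsOpen (lieExp G '' 𝒪)
  contMDiffOn_log :
    ContMDiffOn 𝓘(ℝ, E) 𝓘(ℝ, E) ∞ (Function.invFunOn (lieExp G) 𝒪) (lieExp G '' 𝒪)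
  null_compl : m (lieExp G '' 𝒪)ᶜ = 0
  precompact : ∀ S ⊆ lieExp G '' 𝒪, IsCompact (closure S) →
    IsCompact (closure (𝒪 ∩ lieExp G ⁻¹' S))

end Group

section TestFunctions

variable (E : Type*) [NormedAddCommGroup E] [NormedSpace ℝ E]
variable (G : Type*) [TopologicalSpace G] [ChartedSpace E G]

/-- The space `C^∞_c(G)` of complex-valued smooth functions with compact support. -/
def testFunctions : Submodule ℂ (G → ℂ) where
  carrier := {ψ | ContMDiff 𝓘(ℝ, E) 𝓘(ℝ, ℂ) ∞ ψ ∧ HasCompactSupport ψ}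
  add_mem' := fun ha hb => ⟨ha.1.add hb.1, ha.2.add hb.2⟩
  zero_mem' := ⟨contMDiff_const, HasCompactSupport.zero⟩
  smul_mem' := fun c _ hψ =>
    ⟨((contDiff_const_smul c).contMDiff (n := ∞)).comp hψ.1,
      hψ.2.comp_left (g := fun z => c • z) (smul_zero c)⟩

variable {E G}

lemma memLp_testFunction [MeasurableSpace G] [BorelSpace G] (m : Measure G)
    [IsFiniteMeasureOnCompacts m] (ψ : testFunctions E G) : MemLp (ψ : G → ℂ) 2 m :=
  ψ.2.1.continuous.memLp_of_hasCompactSupport ψ.2.2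

/-- A test function as an element of the Hilbert space `L²(G, m)`. -/
def toL2 [MeasurableSpace G] [BorelSpace G] (m : Measure G)
    [IsFiniteMeasureOnCompacts m] (ψ : testFunctions E G) : Lp ℂ 2 m :=
  (memLp_testFunction m ψ).toLp (ψ : G → ℂ)

end TestFunctions

section PhaseSpace

variable {E : Type*} [NormedAddCommGroup E] [NormedSpace ℝ E] [MeasurableSpace E]

/-- `dp` is the measure on the dual for which Fourier inversion
`f(X) = (2π)^{-n} ∫ f̃(p) e^{i⟨p,X⟩} dp` holds, where `f̃(p) = ∫ f(X) e^{-i⟨p,X⟩} dX`. -/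
def IsFourierDual (dX : Measure E) (dp : Measure (StrongDual ℝ E)) : Prop :=
  ∀ (f : SchwartzMap E ℂ) (X : E),
    f X = (1 / (2 * Real.pi) ^ Module.finrank ℝ E : ℝ) *
      ∫ p : StrongDual ℝ E,
        (∫ Y, f Y * Complex.exp (-Complex.I * (p Y : ℂ)) ∂dX) *
          Complex.exp (Complex.I * (p X : ℂ)) ∂dp

variable {G : Type*} [MeasurableSpace G]

/-- The improper integral over `G × 𝔤*`, with respect to `dm × dp`, of a function `Φ`, obtained by
exhausting `𝔤*` by compactly supported smooth cut-offs `χ(εp)` with `χ(0) = 1` and letting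
`ε → 0⁺`: it exists and has the value `c` if the cut-off integrals converge absolutely and tend to
`c`, for every choice of `χ`. -/
def HasImproperIntegral (m : Measure G) (dp : Measure (StrongDual ℝ E))
    (Φ : G × StrongDual ℝ E → ℂ) (c : ℂ) : Prop :=
  ∀ χ : StrongDual ℝ E → ℝ, ContDiff ℝ ∞ χ → HasCompactSupport χ → χ 0 = 1 →
    (∀ ε : ℝ, 0 < ε →
      Integrable (fun x : G × StrongDual ℝ E => (χ (ε • x.2) : ℂ) * Φ x) (m.prod dp)) ∧
    Filter.Tendsto
      (fun ε : ℝ => ∫ x : G × StrongDual ℝ E, (χ (ε • x.2) : ℂ) * Φ x ∂(m.prod dp))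
      (nhdsWithin 0 (Set.Ioi 0)) (nhds c)

variable [FiniteDimensional ℝ E]
variable [TopologicalSpace G] [ChartedSpace E G] [Group G] [LieGroup 𝓘(ℝ, E) ∞ G]

/-- The Wigner function `𝒲(φ, ψ)(q, p)`, equal to
`∫_𝒪 conj φ(q exp(X/2)) ψ(q exp(-X/2)) e^{-(i/ħ)⟨p,X⟩} F(X) dX`. -/
def wigner (ħ : ℝ) (dX : Measure E) (𝒪 : Set E) (φ ψ : G → ℂ) (x : G × StrongDual ℝ E) : ℂ :=
  ∫ X in 𝒪, (starRingEnd ℂ) (φ (x.1 * lieExp G ((1 / 2 : ℝ) • X))) *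
    ψ (x.1 * lieExp G (-(1 / 2 : ℝ) • X)) *
    Complex.exp (-(Complex.I / (ħ : ℂ)) * (x.2 X : ℂ)) * (jacF G X : ℂ) ∂dX

/-- `A` is the operator in `L²(G, m)`, with domain `C^∞_c(G)`, of the phase-space function `f`:
`(φ, Aψ) = |2πħ|^{-n} ∫_{G × 𝔤*} f 𝒲(φ, ψ) dm dp` for all test functions `φ, ψ`. -/
def IsOperatorOf [BorelSpace G] (ħ : ℝ) (m : Measure G) [IsFiniteMeasureOnCompacts m]
    (dX : Measure E) (dp : Measure (StrongDual ℝ E)) (𝒪 : Set E)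
    (f : G × StrongDual ℝ E → ℂ) (A : testFunctions E G →ₗ[ℂ] Lp ℂ 2 m) : Prop :=
  ∀ φ ψ : testFunctions E G, ∃ c : ℂ,
    HasImproperIntegral m dp (fun x => f x * wigner ħ dX 𝒪 φ ψ x) c ∧
    inner ℂ (toL2 m φ) (A ψ) = (1 / |2 * Real.pi * ħ| ^ Module.finrank ℝ E : ℝ) * c

end PhaseSpace

end LieQuant

end

/-! For a compactly supported cut-off in `p`, the integrand of ∫ f 𝒲(φ, ψ) is bounded with compact
support in `(q, p, X)`: exp X = (q exp(-X/2))⁻¹ (q exp(X/2)) lies in (supp ψ)⁻¹ supp φ, so the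
precompactness hypothesis confines X, and then q, to compact sets. Fubini
(`integral_mul_fourier_prod`) lets one integrate over `G` first. What remains is a function J on the
Lie algebra, J(X) = F(X) ∫ f(q) conj φ(q exp(X/2)) ψ(q exp(-X/2)) dm(q) on `𝒪` and 0 elsewhere,
integrated against ∫ u(εp) e^{-i⟨p,X⟩/ħ} dp.

By Fourier inversion the latter tends to |2πħ|ⁿ u(0) δ₀ as ε → 0
(`tendsto_integral_mul_dualFourier`). For f on `G` take u = χ: the limit is |2πħ|ⁿ J(0) with J(0) =
∫ conj φ f ψ, which is (2). For the fiber variable of X write χ(εp)⟨p,X⟩ = ε⁻¹ u(εp) with u(p) =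
χ(p)⟨p,X⟩. Now u(0) = 0, and the next order yields |2πħ|ⁿ (-iħ) dJ(0)X
(`tendsto_inv_mul_integral_mul_dualFourier`). As λ is even, F(0) = 1 and dF(0) = 0, so F drops out
and dJ(0)X = ½ ∫ (conj(L_X φ) ψ - conj φ L_X ψ). The divergence formula ∫ L_X h dm = tr(ad_X) ∫ h dm
moves the derivative from φ to ψ and produces (1).

The divergence formula (`integral_leftFDeriv_eq_trace_ad`) is proved as follows. Differentiating the
modular character gives ∫ L_X h = c(X) ∫ h with some linear c. The right-invariant field of X equals
∑ aᵢ L_{bᵢ}, where aᵢ(q) are the coordinates of Ad(q⁻¹)X, and it has divergence zero for a left Haar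
measure. Integration by parts gives ∑ (c(bᵢ) aᵢ - L_{bᵢ} aᵢ) = 0 on `G`; at the unit element this
reads c(X) = tr ad_X, because Ad(q⁻¹)X has derivative [X, Y] in direction Y
(`leftFDeriv_conjFDeriv_one`).

Uniqueness of the operators is the density of the test functions in L². -/

open scoped Topology

noncomputable section

namespace LieQuant

/-! ### Calculus in the left trivialization of the tangent bundle -/

section LeftDerivative

variable {E : Type*} [NormedAddCommGroup E] [NormedSpace ℝ E]
variable {G : Type*} [TopologicalSpace G] [ChartedSpace E G] [Group G]
variable {F : Type*} [NormedAddCommGroup F] [NormedSpace ℝ F]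

/-- The differential of `f` at `q`, read in the left trivialization of the tangent bundle. -/
def leftFDeriv (f : G → F) (q : G) : E →L[ℝ] F :=
  mfderiv 𝓘(ℝ, E) 𝓘(ℝ, F) (fun y => f (q * y)) 1

/-- The adjoint action of `q⁻¹` on the Lie algebra. -/
def conjFDeriv (q : G) : E →L[ℝ] E :=
  mfderiv 𝓘(ℝ, E) 𝓘(ℝ, E) (fun y => q⁻¹ * y * q) (1 : G)

variable [LieGroup 𝓘(ℝ, E) ∞ G]

omit [LieGroup 𝓘(ℝ, E) ∞ G] in
lemma tangentBundleCore_coordChange_one [IsManifold 𝓘(ℝ, E) 1 G] :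
    (tangentBundleCore 𝓘(ℝ, E) G).coordChange (achart E (1 : G)) (achart E (1 : G)) 1 =
      ContinuousLinearMap.id ℝ E := by
  ext v
  exact (tangentBundleCore 𝓘(ℝ, E) G).coordChange_self (achart E (1 : G)) 1
    (mem_chart_source E (1 : G)) v

/-- The base point is 1 for every q and the target is a vector space, so all coordinate changes of
the tangent bundles are trivial and the bundle-valued smoothness of `mfderiv` becomes smoothness of
a map into `E →L[ℝ] F`. -/
lemma contMDiff_leftFDeriv {f : G → F} (hf : ContMDiff 𝓘(ℝ, E) 𝓘(ℝ, F) ∞ f) :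
    ContMDiff 𝓘(ℝ, E) 𝓘(ℝ, E →L[ℝ] F) ∞ (leftFDeriv f : G → E →L[ℝ] F) := by
  have : IsManifold 𝓘(ℝ, E) 1 G := IsManifold.of_le (n := ∞) (by exact_mod_cast le_top)
  intro q
  have h := ContMDiffAt.mfderiv (I := 𝓘(ℝ, E)) (J := 𝓘(ℝ, E)) (I' := 𝓘(ℝ, F)) (n := ∞) (m := ∞)
    (x₀ := q) (fun q y => f (q * y)) (fun _ => (1 : G))
    ((hf.comp (contMDiff_mul 𝓘(ℝ, E) ∞)).contMDiffAt) contMDiffAt_const le_rfl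
  refine h.congr_of_eventuallyEq (Filter.Eventually.of_forall fun y => ?_)
  have key := inTangentCoordinates_eq (I := 𝓘(ℝ, E)) (I' := 𝓘(ℝ, F)) (fun _ : G => (1 : G))
    (fun x : G => f (x * 1)) (fun x => (leftFDeriv f x : E →L[ℝ] F)) (x₀ := q) (x := y)
    (mem_chart_source E _) (Set.mem_univ _)
  rw [tangentBundleCore_coordChange_one, tangentBundleCore_coordChange_model_space] at key
  exact key.symm

/-- Conjugation fixes the unit element, so the differential stays in the single fibre over 1 and no
coordinate change intervenes. -/
lemma contMDiff_conjFDeriv :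
    ContMDiff 𝓘(ℝ, E) 𝓘(ℝ, E →L[ℝ] E) ∞ (conjFDeriv : G → E →L[ℝ] E) := by
  have : IsManifold 𝓘(ℝ, E) 1 G := IsManifold.of_le (n := ∞) (by exact_mod_cast le_top)
  intro q
  have hc : ContMDiff (𝓘(ℝ, E).prod 𝓘(ℝ, E)) 𝓘(ℝ, E) ∞ (fun p : G × G => p.1⁻¹ * p.2 * p.1) :=
    ((contMDiff_fst.inv).mul contMDiff_snd).mul contMDiff_fst
  have h := ContMDiffAt.mfderiv (I := 𝓘(ℝ, E)) (J := 𝓘(ℝ, E)) (I' := 𝓘(ℝ, E)) (n := ∞) (m := ∞)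
    (x₀ := q) (fun q y : G => q⁻¹ * y * q) (fun _ => (1 : G))
    (hc.contMDiffAt) contMDiffAt_const le_rfl
  refine h.congr_of_eventuallyEq (Filter.Eventually.of_forall fun y => ?_)
  have h1 : ∀ y : G, y⁻¹ * 1 * y = 1 := fun y => by simp
  have key := inTangentCoordinates_eq (I := 𝓘(ℝ, E)) (I' := 𝓘(ℝ, E)) (fun _ : G => (1 : G))
    (fun x : G => x⁻¹ * 1 * x) (fun x => (conjFDeriv x : E →L[ℝ] E)) (x₀ := q) (x := y)
    (mem_chart_source E _) (by rw [h1, h1]; exact mem_chart_source E _)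
  refine Eq.trans ?_ key.symm
  simp only [h1]
  rw [tangentBundleCore_coordChange_one]
  rfl

lemma mdifferentiableAt_mul_left (q y : G) :
    MDifferentiableAt 𝓘(ℝ, E) 𝓘(ℝ, E) (fun y => q * y) y :=
  (contMDiff_mul_left (I := 𝓘(ℝ, E)) (n := ∞) (a := q)).mdifferentiable (by simp) y

lemma mfderiv_mulInvariantVectorField {f : G → F} {q : G}
    (hf : MDifferentiableAt 𝓘(ℝ, E) 𝓘(ℝ, F) f q) (X : E) :
    mfderiv 𝓘(ℝ, E) 𝓘(ℝ, F) f q (mulInvariantVectorField (X : GroupLieAlgebra 𝓘(ℝ, E) G) q) =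
      leftFDeriv f q X := by
  have h := mfderiv_comp_of_eq (I := 𝓘(ℝ, E)) (I' := 𝓘(ℝ, E)) (I'' := 𝓘(ℝ, F)) (x := (1 : G))
    (g := f) (f := fun y => q * y) (y := q) hf
    (mdifferentiableAt_mul_left q 1) (by simp)
  rw [leftFDeriv]
  change _ = mfderiv 𝓘(ℝ, E) 𝓘(ℝ, F) (f ∘ fun y => q * y) 1 X
  rw [h]
  -- The chain rule gives the differential at `q * 1`, whose type depends on the point; the equality
  -- is transported with all fibres read as `E`.
  have h2 : ∀ q', q' = q → (mfderiv 𝓘(ℝ, E) 𝓘(ℝ, F) f q : E →L[ℝ] F) =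
    mfderiv 𝓘(ℝ, E) 𝓘(ℝ, F) f q' := by rintro _ rfl; rfl
  exact DFunLike.congr_fun (h2 (q * 1) (mul_one q))
    (mulInvariantVectorField (X : GroupLieAlgebra 𝓘(ℝ, E) G) q)

lemma lieDeriv_eq_leftFDeriv {f : G → ℂ} (hf : ContMDiff 𝓘(ℝ, E) 𝓘(ℝ, ℂ) ∞ f) (X : E) (q : G) :
    lieDeriv X f q = leftFDeriv f q X :=
  mfderiv_mulInvariantVectorField (hf.mdifferentiable (by simp) q) X

/-- The chain rule along a map into the group through the unit element. -/
lemma hasFDerivAt_comp_mul_left {P : Type*} [NormedAddCommGroup P] [NormedSpace ℝ P]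
    {f : G → F} (hf : ContMDiff 𝓘(ℝ, E) 𝓘(ℝ, F) ∞ f) {γ : P → G} {p : P} {γ' : P →L[ℝ] E}
    (hp : γ p = 1) (hγ : HasMFDerivAt 𝓘(ℝ, P) 𝓘(ℝ, E) γ p γ') (q : G) :
    HasFDerivAt (fun x => f (q * γ x)) ((leftFDeriv f q).comp γ') p := by
  have h1 : MDifferentiableAt 𝓘(ℝ, E) 𝓘(ℝ, F) (fun y => f (q * y)) (γ p) :=
    (hf.comp (contMDiff_mul_left (I := 𝓘(ℝ, E)) (n := ∞) (a := q))).mdifferentiable (by simp) _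
  rw [hp] at h1
  have h2 : HasMFDerivAt 𝓘(ℝ, E) 𝓘(ℝ, F) (fun y => f (q * y)) (γ p)
      (leftFDeriv f q : E →L[ℝ] F) := by
    rw [hp]
    exact h1.hasMFDerivAt
  have h : HasMFDerivAt 𝓘(ℝ, P) 𝓘(ℝ, F) (fun x => f (q * γ x)) p
    ((leftFDeriv f q : E →L[ℝ] F).comp γ') := h2.comp p hγ
  exact h.hasFDerivAt

/-- Write γ q = q (q⁻¹ γ q) and apply the left version to the conjugated map. -/
lemma hasFDerivAt_comp_mul_right {P : Type*} [NormedAddCommGroup P] [NormedSpace ℝ P]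
    {f : G → F} (hf : ContMDiff 𝓘(ℝ, E) 𝓘(ℝ, F) ∞ f) {γ : P → G} {p : P} {γ' : P →L[ℝ] E}
    (hp : γ p = 1) (hγ : HasMFDerivAt 𝓘(ℝ, P) 𝓘(ℝ, E) γ p γ') (q : G) :
    HasFDerivAt (fun x => f (γ x * q)) (((leftFDeriv f q).comp (conjFDeriv q)).comp γ') p := by
  have hc : ContMDiff 𝓘(ℝ, E) 𝓘(ℝ, E) ∞ (fun y : G => q⁻¹ * y * q) :=
    (contMDiff_const.mul contMDiff_id).mul contMDiff_const
  have h1 : HasMFDerivAt 𝓘(ℝ, E) 𝓘(ℝ, E) (fun y : G => q⁻¹ * y * q) (γ p) (conjFDeriv (E := E) q) := by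
    rw [hp]
    exact (hc.mdifferentiable (by simp) _).hasMFDerivAt
  have h2 : HasMFDerivAt 𝓘(ℝ, P) 𝓘(ℝ, E) (fun x => q⁻¹ * γ x * q) p ((conjFDeriv (E := E) q).comp γ') :=
    h1.comp p hγ
  have h := hasFDerivAt_comp_mul_left hf (by simp [hp]) h2 q
  simpa [mul_assoc] using! h

variable (G) in
/-- A parametrization of a neighbourhood of the unit element, centred at `0`. -/
def unitChart (x : E) : G := (extChartAt 𝓘(ℝ, E) (1 : G)).symm (extChartAt 𝓘(ℝ, E) (1 : G) 1 + x)

omit [LieGroup 𝓘(ℝ, E) ∞ G] in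
@[simp] lemma unitChart_zero : unitChart G (0 : E) = 1 := by simp [unitChart]

omit [LieGroup 𝓘(ℝ, E) ∞ G] in
lemma eventually_add_mem_target : ∀ᶠ x in 𝓝 (0 : E),
    extChartAt 𝓘(ℝ, E) (1 : G) 1 + x ∈ (extChartAt 𝓘(ℝ, E) (1 : G)).target := by
  have h : Filter.Tendsto (fun x : E => extChartAt 𝓘(ℝ, E) (1 : G) 1 + x) (𝓝 0)
      (𝓝 (extChartAt 𝓘(ℝ, E) (1 : G) 1)) := by
    have : Continuous (fun x : E => extChartAt 𝓘(ℝ, E) (1 : G) 1 + x) := by fun_prop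
    simpa using this.tendsto 0
  exact h (extChartAt_target_mem_nhds (I := 𝓘(ℝ, E)) (1 : G))

lemma contMDiffAt_unitChart : ContMDiffAt 𝓘(ℝ, E) 𝓘(ℝ, E) ∞ (unitChart G : E → G) 0 := by
  have : IsManifold 𝓘(ℝ, E) ∞ G := inferInstance
  have h1 : ContMDiffAt 𝓘(ℝ, E) 𝓘(ℝ, E) ∞ (extChartAt 𝓘(ℝ, E) (1 : G)).symm
      (extChartAt 𝓘(ℝ, E) (1 : G) 1 + 0) := by
    rw [add_zero]
    exact (contMDiffOn_extChartAt_symm (1 : G)).contMDiffAt (extChartAt_target_mem_nhds (1 : G))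
  have h2 : ContMDiffAt 𝓘(ℝ, E) 𝓘(ℝ, E) ∞ (fun x : E => extChartAt 𝓘(ℝ, E) (1 : G) 1 + x) 0 :=
    (contDiff_const.add contDiff_id).contMDiff.contMDiffAt
  exact h1.comp (0 : E) h2

lemma hasMFDerivAt_unitChart : HasMFDerivAt 𝓘(ℝ, E) 𝓘(ℝ, E) (unitChart G : E → G) 0
    (ContinuousLinearMap.id ℝ E) := by
  refine ⟨contMDiffAt_unitChart.continuousAt, ?_⟩
  have h : HasFDerivAt (fun x : E => extChartAt 𝓘(ℝ, E) (1 : G) 1 + x)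
    (ContinuousLinearMap.id ℝ E) 0 := (hasFDerivAt_id _).const_add _
  refine (h.congr_of_eventuallyEq ?_).hasFDerivWithinAt
  filter_upwards [eventually_add_mem_target (E := E) (G := G)] with x hx
  rw [writtenInExtChartAt, unitChart_zero]
  exact (extChartAt 𝓘(ℝ, E) (1 : G)).right_inv hx

/-- This presents `leftFDeriv` as an ordinary Fréchet derivative, so that the product and chain
rules below are those of normed spaces. -/
lemma hasFDerivAt_mul_unitChart {f : G → F} (hf : ContMDiff 𝓘(ℝ, E) 𝓘(ℝ, F) ∞ f) (q : G) :
    HasFDerivAt (fun x : E => f (q * unitChart G x)) (leftFDeriv f q) 0 :=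
  hasFDerivAt_comp_mul_left hf unitChart_zero hasMFDerivAt_unitChart q

lemma leftFDeriv_smul {u : G → ℝ} {f : G → F} (hu : ContMDiff 𝓘(ℝ, E) 𝓘(ℝ, ℝ) ∞ u)
    (hf : ContMDiff 𝓘(ℝ, E) 𝓘(ℝ, F) ∞ f) (q : G) (X : E) :
    leftFDeriv (fun y => u y • f y) q X = leftFDeriv u q X • f q + u q • leftFDeriv f q X := by
  have h := (hasFDerivAt_mul_unitChart hu q).smul (hasFDerivAt_mul_unitChart hf q)
  rw [(hasFDerivAt_mul_unitChart (f := fun y => u y • f y) (hu.smul hf) q).unique h]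
  simp [add_comm]

lemma leftFDeriv_mul {u f : G → ℂ} (hu : ContMDiff 𝓘(ℝ, E) 𝓘(ℝ, ℂ) ∞ u)
    (hf : ContMDiff 𝓘(ℝ, E) 𝓘(ℝ, ℂ) ∞ f) (q : G) (X : E) :
    leftFDeriv (fun y => u y * f y) q X = leftFDeriv u q X * f q + u q * leftFDeriv f q X := by
  have h := (hasFDerivAt_mul_unitChart hu q).mul (hasFDerivAt_mul_unitChart hf q)
  have h2 : ContMDiff 𝓘(ℝ, E) 𝓘(ℝ, ℂ) ∞ (fun y => u y * f y) := by
    have hm : ContDiff ℝ ∞ (fun p : ℂ × ℂ => p.1 * p.2) := contDiff_fst.mul contDiff_snd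
    exact hm.contMDiff.comp (hu.prodMk_space hf)
  rw [(hasFDerivAt_mul_unitChart h2 q).unique h]
  simp [add_comm, mul_comm]

lemma leftFDeriv_clm_apply {F' : Type*} [NormedAddCommGroup F'] [NormedSpace ℝ F']
    {A : G → F →L[ℝ] F'} {f : G → F} (hA : ContMDiff 𝓘(ℝ, E) 𝓘(ℝ, F →L[ℝ] F') ∞ A)
    (hf : ContMDiff 𝓘(ℝ, E) 𝓘(ℝ, F) ∞ f) (q : G) (X : E) :
    leftFDeriv (fun y => A y (f y)) q X = leftFDeriv A q X (f q) + A q (leftFDeriv f q X) := by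
  have h := (hasFDerivAt_mul_unitChart hA q).clm_apply (hasFDerivAt_mul_unitChart hf q)
  rw [(hasFDerivAt_mul_unitChart (hA.clm_apply hf) q).unique h]
  simp [add_comm]

lemma leftFDeriv_clm_comp {F' : Type*} [NormedAddCommGroup F'] [NormedSpace ℝ F']
    (L : F →L[ℝ] F') {f : G → F}
    (hf : ContMDiff 𝓘(ℝ, E) 𝓘(ℝ, F) ∞ f) (q : G) (X : E) :
    leftFDeriv (fun y => L (f y)) q X = L (leftFDeriv f q X) := by
  have h := L.hasFDerivAt.comp (0 : E) (hasFDerivAt_mul_unitChart hf q)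
  rw [(hasFDerivAt_mul_unitChart (f := fun y => L (f y)) (L.contMDiff.comp hf) q).unique h]
  simp

end LeftDerivative

lemma one_add_one_le_infty : (1 : WithTop ℕ∞) + 1 ≤ ∞ := by
  rw [one_add_one_eq_two]
  exact ENat.LEInfty.out

/-! ### The Lie bracket and the derivative of the adjoint action -/

section Bracket

variable {E : Type*} [NormedAddCommGroup E] [NormedSpace ℝ E]
variable {G : Type*} [TopologicalSpace G] [ChartedSpace E G] [Group G]
variable {F : Type*} [NormedAddCommGroup F] [NormedSpace ℝ F]

section
variable (G)

/-- The left-invariant vector field of `X`, read in the chart at the unit element. -/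
def chartField (X : E) : E → E :=
  VectorField.mpullbackWithin 𝓘(ℝ, E) 𝓘(ℝ, E) (extChartAt 𝓘(ℝ, E) (1 : G)).symm
    (mulInvariantVectorField (X : GroupLieAlgebra 𝓘(ℝ, E) G)) Set.univ

/-- The manifold bracket is the bracket of the fields read in a chart, pulled back by the chart; the
differential of the chart at its own centre is the identity, so nothing is left of the pullback. -/
lemma bracket_eq_lieBracket_chartField [IsManifold 𝓘(ℝ, E) 1 G] (X Y : E) :
    bracket G X Y = VectorField.lieBracket ℝ (chartField G X) (chartField G Y)
      (extChartAt 𝓘(ℝ, E) (1 : G) 1) := by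
  refine (GroupLieAlgebra.bracket_def (I := 𝓘(ℝ, E)) (G := G) X Y).trans ?_
  rw [← VectorField.mlieBracketWithin_univ,
    VectorField.mlieBracketWithin_apply]
  have h : mfderiv 𝓘(ℝ, E) 𝓘(ℝ, E) (extChartAt 𝓘(ℝ, E) (1 : G)) (1 : G) =
    ContinuousLinearMap.id ℝ E := by
    exact mfderiv_extChartAt_self (I := 𝓘(ℝ, E)) (x := (1 : G))
  rw [h]
  simp only [modelWithCornersSelf_coe, Set.range_id, Set.preimage_univ, Set.inter_univ,
    chartField]
  erw [ContinuousLinearMap.inverse_id]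
  exact congrFun (VectorField.lieBracketWithin_univ (𝕜 := ℝ) (V := chartField G X)
    (W := chartField G Y)) _

lemma mulInvariantVectorField_eq_of_eq_one (X : E) {q : G} (hq : q = 1) :
    mulInvariantVectorField (I := 𝓘(ℝ, E)) (X : GroupLieAlgebra 𝓘(ℝ, E) G) q = X := by
  subst hq
  have h : (fun y : G => 1 * y) = id := funext fun y => one_mul y
  have h2 : (mfderiv 𝓘(ℝ, E) 𝓘(ℝ, E) (fun y : G => 1 * y) 1 : E →L[ℝ] E) =
    ContinuousLinearMap.id ℝ E := by rw [h]; exact mfderiv_id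
  exact DFunLike.congr_fun h2 X

lemma chartField_apply_one [IsManifold 𝓘(ℝ, E) 1 G] (X : E) :
    chartField G X (extChartAt 𝓘(ℝ, E) (1 : G) 1) = X := by
  have h := mfderivWithin_extChartAt_symm_inverse_apply (I := 𝓘(ℝ, E)) (x := (1 : G)) X
  rw [modelWithCornersSelf_coe, Set.range_id] at h
  have h2 := mulInvariantVectorField_eq_of_eq_one (G := G) X
    (extChartAt_to_inv (I := 𝓘(ℝ, E)) (1 : G))
  rw [chartField, VectorField.mpullbackWithin_apply]
  exact (congrArg _ h2).trans h

end

variable [LieGroup 𝓘(ℝ, E) ∞ G]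

lemma differentiableAt_chartField [CompleteSpace E] (X : E) :
    DifferentiableAt ℝ (chartField G X) (extChartAt 𝓘(ℝ, E) (1 : G) 1) := by
  have : IsManifold 𝓘(ℝ, E) 2 G := IsManifold.of_le (n := ∞) ENat.LEInfty.out
  have h := MDifferentiableWithinAt.differentiableWithinAt_mpullbackWithin_vectorField
    (I := 𝓘(ℝ, E)) (s := Set.univ) (x := (1 : G))
    (mdifferentiableAt_mulInvariantVectorField (I := 𝓘(ℝ, E)) (g := (1 : G)) X).mdifferentiableWithinAt
  have h' : DifferentiableWithinAt ℝ (chartField G X) Set.univ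
      (extChartAt 𝓘(ℝ, E) (1 : G) 1) := by
    rwa [modelWithCornersSelf_coe, Set.range_id, Set.preimage_univ, Set.inter_univ] at h
  exact differentiableWithinAt_univ.1 h'

/-- Pulling the field back by the inverse chart and differentiating f along the inverse chart
cancel. -/
lemma fderiv_comp_unitChart_chartField {f : G → F} (hf : ContMDiff 𝓘(ℝ, E) 𝓘(ℝ, F) ∞ f) {x : E}
    (hx : extChartAt 𝓘(ℝ, E) (1 : G) 1 + x ∈ (extChartAt 𝓘(ℝ, E) (1 : G)).target) (X : E) :
    fderiv ℝ (fun x => f (unitChart G x)) x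
      (chartField G X (extChartAt 𝓘(ℝ, E) (1 : G) 1 + x)) =
      leftFDeriv f (unitChart G x) X := by
  have hM : IsManifold 𝓘(ℝ, E) 1 G := IsManifold.of_le (n := ∞) ENat.LEInfty.out
  set c := extChartAt 𝓘(ℝ, E) (1 : G) 1 + x with hc
  have h1 : MDifferentiableAt 𝓘(ℝ, E) 𝓘(ℝ, E) (extChartAt 𝓘(ℝ, E) (1 : G)).symm c := by
    have h := mdifferentiableWithinAt_extChartAt_symm (I := 𝓘(ℝ, E)) hx
    rwa [modelWithCornersSelf_coe, Set.range_id, mdifferentiableWithinAt_univ] at h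
  have h2 : MDifferentiableAt 𝓘(ℝ, E) 𝓘(ℝ, F) f ((extChartAt 𝓘(ℝ, E) (1 : G)).symm c) :=
    hf.mdifferentiable (by simp) _
  have h3 : fderiv ℝ (fun x => f (unitChart G x)) x =
      mfderiv 𝓘(ℝ, E) 𝓘(ℝ, F) (f ∘ (extChartAt 𝓘(ℝ, E) (1 : G)).symm) c := by
    rw [mfderiv_eq_fderiv, hc]
    exact fderiv_comp_add_left (f := f ∘ (extChartAt 𝓘(ℝ, E) (1 : G)).symm) _
  have hinv := isInvertible_mfderivWithin_extChartAt_symm (I := 𝓘(ℝ, E)) hx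
  refine Eq.trans ?_ (mfderiv_mulInvariantVectorField h2 X)
  rw [modelWithCornersSelf_coe, Set.range_id, mfderivWithin_univ] at hinv
  rw [h3, mfderiv_comp _ h2 h1, chartField]
  refine (congrArg (mfderiv 𝓘(ℝ, E) 𝓘(ℝ, F) f ((extChartAt 𝓘(ℝ, E) (1 : G)).symm c)) ?_)
  rw [VectorField.mpullbackWithin_apply, mfderivWithin_univ]
  exact hinv.self_apply_inverse _

/-- In the chart, L_X f is Dg applied to the coordinate field of X. Its derivative has a
second-order part, symmetric in X and Y, which cancels in the commutator; the first-order parts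
combine into Dg of the coordinate bracket. -/
lemma leftFDeriv_bracket [CompleteSpace E] {f : G → F} (hf : ContMDiff 𝓘(ℝ, E) 𝓘(ℝ, F) ∞ f)
    (X Y : E) :
    leftFDeriv f (1 : G) (bracket G X Y) =
      leftFDeriv (fun q => leftFDeriv f q Y) (1 : G) X -
        leftFDeriv (fun q => leftFDeriv f q X) (1 : G) Y := by
  have hM : IsManifold 𝓘(ℝ, E) 1 G := IsManifold.of_le (n := ∞) ENat.LEInfty.out
  set c := extChartAt 𝓘(ℝ, E) (1 : G) 1 with hc
  set g : E → F := fun x => f (unitChart G x)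
  have hg : ContDiffAt ℝ ∞ g 0 :=
    (hf.contMDiffAt.comp (0 : E) contMDiffAt_unitChart).contDiffAt
  have hg' : DifferentiableAt ℝ (fderiv ℝ g) 0 :=
    (hg.fderiv_right (m := 1) one_add_one_le_infty).differentiableAt (by simp)
  have hfd : fderiv ℝ g 0 = leftFDeriv f 1 := by
    simpa using (hasFDerivAt_mul_unitChart hf 1).fderiv
  have hD (X : E) : ContMDiff 𝓘(ℝ, E) 𝓘(ℝ, F) ∞ (fun q : G => leftFDeriv f q X) :=
    (contMDiff_leftFDeriv hf).clm_apply contMDiff_const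
  set V : E → E → E := fun X x => chartField G X (c + x)
  have hV (X : E) : HasFDerivAt (V X) (fderiv ℝ (chartField G X) c) 0 := by
    have h : HasFDerivAt (chartField G X) (fderiv ℝ (chartField G X) c) (c + 0) := by
      rw [add_zero]; exact (differentiableAt_chartField (G := G) X).hasFDerivAt
    exact h.comp (0 : E) ((hasFDerivAt_id (0 : E)).const_add c)
  have h0 (X : E) : chartField G X c = X := chartField_apply_one G X
  have hVX (X : E) : V X 0 = X := by simp [V, h0]
  have key (X Y : E) : leftFDeriv (fun q => leftFDeriv f q X) (1 : G) Y =
      fderiv ℝ (fderiv ℝ g) 0 Y X + leftFDeriv f (1 : G) (fderiv ℝ (chartField G X) c Y) := by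
    have h1 := hasFDerivAt_mul_unitChart (hD X) 1
    have h2 := hg'.hasFDerivAt.clm_apply (hV X)
    have h3 : (fun x => leftFDeriv f (1 * unitChart G x) X) =ᶠ[𝓝 0]
        fun x => fderiv ℝ g x (V X x) := by
      filter_upwards [eventually_add_mem_target (E := E) (G := G)] with x hx
      rw [one_mul, ← fderiv_comp_unitChart_chartField hf hx]
    rw [h1.unique (h2.congr_of_eventuallyEq h3)]
    simp [hVX, hfd, add_comm]
  have hsymm : fderiv ℝ (fderiv ℝ g) 0 X Y = fderiv ℝ (fderiv ℝ g) 0 Y X :=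
    hg.isSymmSndFDerivAt (by simpa using ENat.LEInfty.out) X Y
  rw [key, key, bracket_eq_lieBracket_chartField, VectorField.lieBracket_eq, map_sub, hsymm]
  rw [← hc, h0, h0]
  abel

/-- Left- and right-invariant vector fields commute. -/
lemma leftFDeriv_conjFDeriv_comm {f : G → F} (hf : ContMDiff 𝓘(ℝ, E) 𝓘(ℝ, F) ∞ f) (X Y : E) :
    leftFDeriv (fun q => leftFDeriv f q (conjFDeriv q X)) (1 : G) Y =
      leftFDeriv (fun q => leftFDeriv f q Y) (1 : G) X := by
  -- Both sides are mixed second derivatives at 0 of f(xy), with x moving in direction X and y in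
  -- direction Y: differentiating first in x yields the right-invariant field, first in y the
  -- left-invariant one.
  set w : E × E → F := fun p => f (unitChart G p.1 * unitChart G p.2) with hwdef
  have hw : ContDiffAt ℝ ∞ w 0 := by
    have h1 : ContMDiffAt 𝓘(ℝ, E × E) 𝓘(ℝ, E) ∞ (fun p : E × E => unitChart G p.1) 0 :=
      ContMDiffAt.comp (g := unitChart G) (0 : E × E) contMDiffAt_unitChart
        contDiff_fst.contMDiff.contMDiffAt
    have h2 : ContMDiffAt 𝓘(ℝ, E × E) 𝓘(ℝ, E) ∞ (fun p : E × E => unitChart G p.2) 0 :=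
      ContMDiffAt.comp (g := unitChart G) (0 : E × E) contMDiffAt_unitChart
        contDiff_snd.contMDiff.contMDiffAt
    exact (hf.contMDiffAt.comp (0 : E × E) (h1.mul h2)).contDiffAt
  have hw' : HasFDerivAt (fderiv ℝ w) (fderiv ℝ (fderiv ℝ w) 0) 0 :=
    ((hw.fderiv_right (m := 1) one_add_one_le_infty).differentiableAt
      (by simp)).hasFDerivAt
  have hev : ∀ᶠ p in 𝓝 (0 : E × E), DifferentiableAt ℝ w p := by
    filter_upwards [(hw.of_le (m := 1) ENat.LEInfty.out).eventually (by simp)] with p hp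
    exact hp.differentiableAt (by simp)
  have hl : HasFDerivAt (fun x : E => (x, (0 : E))) (ContinuousLinearMap.inl ℝ E E) 0 :=
    (ContinuousLinearMap.inl ℝ E E).hasFDerivAt
  have hr : HasFDerivAt (fun y : E => ((0 : E), y)) (ContinuousLinearMap.inr ℝ E E) 0 :=
    (ContinuousLinearMap.inr ℝ E E).hasFDerivAt
  have hsymm := hw.isSymmSndFDerivAt (by simpa using ENat.LEInfty.out)
    (ContinuousLinearMap.inl ℝ E E X) (ContinuousLinearMap.inr ℝ E E Y)
  have hDf := contMDiff_leftFDeriv hf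
  have e1 : leftFDeriv (fun q => leftFDeriv f q (conjFDeriv q X)) (1 : G) Y =
      fderiv ℝ (fderiv ℝ w) 0 (ContinuousLinearMap.inr ℝ E E Y)
        (ContinuousLinearMap.inl ℝ E E X) := by
    have h1 := hasFDerivAt_mul_unitChart
      (hDf.clm_apply (contMDiff_conjFDeriv.clm_apply (contMDiff_const (c := X)))) (1 : G)
    have h2 := (HasFDerivAt.comp (g := fderiv ℝ w) (f := fun y => ((0 : E), y)) (0 : E) hw' hr).clm_apply
      (hasFDerivAt_const (ContinuousLinearMap.inl ℝ E E X) (0 : E))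
    rw [h1.unique (h2.congr_of_eventuallyEq ?_)]
    · simp
    · have hc : Filter.Tendsto (fun y : E => ((0 : E), y)) (𝓝 0) (𝓝 0) := hr.continuousAt
      filter_upwards [hc.eventually hev] with y hy
      have h3 := HasFDerivAt.comp (g := w) (f := fun x => (x, y)) (0 : E) hy.hasFDerivAt
        ((hasFDerivAt_id (0 : E)).prodMk (hasFDerivAt_const y (0 : E)))
      have h4 := hasFDerivAt_comp_mul_right hf unitChart_zero hasMFDerivAt_unitChart
        (unitChart G y)
      have h5 := DFunLike.congr_fun (h4.unique h3) X
      simpa using h5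
  have e2 : leftFDeriv (fun q => leftFDeriv f q Y) (1 : G) X =
      fderiv ℝ (fderiv ℝ w) 0 (ContinuousLinearMap.inl ℝ E E X)
        (ContinuousLinearMap.inr ℝ E E Y) := by
    have h1 := hasFDerivAt_mul_unitChart (hDf.clm_apply (contMDiff_const (c := Y))) (1 : G)
    have h2 := (HasFDerivAt.comp (g := fderiv ℝ w) (f := fun x => (x, (0 : E))) (0 : E) hw' hl).clm_apply
      (hasFDerivAt_const (ContinuousLinearMap.inr ℝ E E Y) (0 : E))
    rw [h1.unique (h2.congr_of_eventuallyEq ?_)]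
    · simp
    · have hc : Filter.Tendsto (fun x : E => (x, (0 : E))) (𝓝 0) (𝓝 0) := hl.continuousAt
      filter_upwards [hc.eventually hev] with x hx
      have h3 := HasFDerivAt.comp (g := w) (f := fun y => (x, y)) (0 : E) hx.hasFDerivAt
        ((hasFDerivAt_const x (0 : E)).prodMk (hasFDerivAt_id (0 : E)))
      have h4 := hasFDerivAt_mul_unitChart hf (unitChart G x)
      have h5 := DFunLike.congr_fun (h4.unique h3) Y
      simpa using h5
  rw [e1, e2, hsymm]

omit [LieGroup 𝓘(ℝ, E) ∞ G] in
lemma conjFDeriv_one : (conjFDeriv (1 : G) : E →L[ℝ] E) = ContinuousLinearMap.id ℝ E := by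
  have h : (fun y : G => (1 : G)⁻¹ * y * 1) = id := funext fun y => by simp
  rw [conjFDeriv, h]
  exact mfderiv_id

/-- A chart cut off by a bump function. It provides a global test map from which a vector can be
recovered by differentiating at 1. -/
lemma exists_contMDiff_leftFDeriv_one_eq_id [FiniteDimensional ℝ E] [T2Space G] :
    ∃ f : G → E, ContMDiff 𝓘(ℝ, E) 𝓘(ℝ, E) ∞ f ∧
      leftFDeriv f (1 : G) = ContinuousLinearMap.id ℝ E := by
  obtain ⟨b⟩ : Nonempty (SmoothBumpFunction 𝓘(ℝ, E) (1 : G)) := inferInstance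
  have hf : ContMDiff 𝓘(ℝ, E) 𝓘(ℝ, E) ∞ (fun q => b q • extChartAt 𝓘(ℝ, E) (1 : G) q) :=
    b.contMDiff_smul contMDiffOn_extChartAt
  refine ⟨_, hf, ?_⟩
  have h1 := hasFDerivAt_mul_unitChart hf 1
  have h2 : HasFDerivAt (fun x : E => extChartAt 𝓘(ℝ, E) (1 : G) 1 + x)
    (ContinuousLinearMap.id ℝ E) 0 := (hasFDerivAt_id _).const_add _
  refine h1.unique (h2.congr_of_eventuallyEq ?_)
  have hc : Filter.Tendsto (unitChart G) (𝓝 (0 : E)) (𝓝 1) := by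
    simpa using (contMDiffAt_unitChart (E := E) (G := G)).continuousAt.tendsto
  filter_upwards [eventually_add_mem_target (E := E) (G := G),
    hc.eventually b.eventuallyEq_one] with x hx hb
  rw [one_mul, hb]
  simp only [Pi.one_apply, one_smul]
  exact (extChartAt 𝓘(ℝ, E) (1 : G)).right_inv hx

/-- The differential of the adjoint action at the unit element. -/
lemma leftFDeriv_conjFDeriv_one [FiniteDimensional ℝ E] [T2Space G] (X Y : E) :
    leftFDeriv (fun q : G => conjFDeriv q X) (1 : G) Y = bracket G X Y := by
  have := FiniteDimensional.complete ℝ E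
  obtain ⟨f, hf, hid⟩ := exists_contMDiff_leftFDeriv_one_eq_id (E := E) (G := G)
  have hDf := contMDiff_leftFDeriv hf
  have hA : ContMDiff 𝓘(ℝ, E) 𝓘(ℝ, E) ∞ (fun q : G => conjFDeriv q X) :=
    contMDiff_conjFDeriv.clm_apply contMDiff_const
  have h1 := leftFDeriv_conjFDeriv_comm hf X Y
  have h2 := leftFDeriv_clm_apply hDf (contMDiff_const (c := X)) (1 : G) Y
  have h3 := leftFDeriv_bracket hf X Y
  -- The product rule splits the derivative of Df(q)(Ad(q⁻¹)X) into a second derivative of f and the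
  -- wanted derivative of Ad(q⁻¹)X. Commutation of left and right fields exhibits the latter as L_X
  -- L_Y f - L_Y L_X f at 1.
  rw [leftFDeriv_clm_apply hDf hA] at h1
  have h4 : leftFDeriv (fun _ : G => X) (1 : G) Y = 0 := by
    have h := hasFDerivAt_mul_unitChart (E := E) (contMDiff_const (c := X)) (1 : G)
    rw [h.unique (hasFDerivAt_const X 0)]
    rfl
  rw [h4, map_zero, add_zero] at h2
  rw [conjFDeriv_one, ContinuousLinearMap.id_apply, hid, ContinuousLinearMap.id_apply, ← h2] at h1
  rw [hid, ContinuousLinearMap.id_apply, ← h1] at h3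
  rw [h3]
  abel

end Bracket

/-! ### Differentiation under an integral over the group -/

section Integral

variable {E : Type*} [NormedAddCommGroup E] [NormedSpace ℝ E]
variable {G : Type*} [TopologicalSpace G] [ChartedSpace E G]
variable {F : Type*} [NormedAddCommGroup F] [NormedSpace ℝ F]
variable {P : Type*} [NormedAddCommGroup P] [NormedSpace ℝ P]

/-- Joint continuity of the partial derivative, from which its bound on a compact set follows. -/
lemma continuousAt_fderiv_of_contMDiffAt [IsManifold 𝓘(ℝ, E) ∞ G] {Φ : P → G → F} {x : P} {q : G}
    (h : ContMDiffAt (𝓘(ℝ, P).prod 𝓘(ℝ, E)) 𝓘(ℝ, F) ∞ (Function.uncurry Φ) (x, q)) :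
    ContinuousAt (fun p : P × G => fderiv ℝ (fun y => Φ y p.2) p.1) (x, q) := by
  have h1 : ContMDiffAt ((𝓘(ℝ, P).prod 𝓘(ℝ, E)).prod 𝓘(ℝ, P)) 𝓘(ℝ, F) ∞
      (Function.uncurry (fun (p : P × G) (y : P) => Φ y p.2)) ((x, q), x) := by
    have h2 : ContMDiffAt ((𝓘(ℝ, P).prod 𝓘(ℝ, E)).prod 𝓘(ℝ, P)) (𝓘(ℝ, P).prod 𝓘(ℝ, E)) ∞
        (fun z : (P × G) × P => (z.2, z.1.2)) ((x, q), x) :=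
      (contMDiff_snd.prodMk (contMDiff_snd.comp contMDiff_fst)).contMDiffAt
    exact ContMDiffAt.comp (g := Function.uncurry Φ) ((x, q), x) h h2
  have h3 := ContMDiffAt.mfderiv (J := 𝓘(ℝ, P).prod 𝓘(ℝ, E)) (I := 𝓘(ℝ, P)) (I' := 𝓘(ℝ, F))
    (n := ∞) (m := ∞)
    (x₀ := (x, q)) (fun (p : P × G) (y : P) => Φ y p.2) (fun p => p.1) h1 contMDiffAt_fst le_rfl
  refine h3.continuousAt.congr (Filter.Eventually.of_forall fun y => ?_)
  simp [inTangentCoordinates_model_space]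

variable [MeasurableSpace G] [BorelSpace G] [SecondCountableTopology G] [T2Space G]

/-- For parameters in the closed ball the functions vanish off one compact set, on which the
parameter derivative is uniformly bounded; this constant on `K` dominates. -/
lemma exists_hasFDerivAt_integral [FiniteDimensional ℝ P] [IsManifold 𝓘(ℝ, E) ∞ G] (m : Measure G)
    [IsFiniteMeasureOnCompacts m] {Φ : P → G → F} {r : ℝ} (hr : 0 < r)
    (hΦ : ∀ x ∈ Metric.closedBall (0 : P) r, ∀ q,
      ContMDiffAt (𝓘(ℝ, P).prod 𝓘(ℝ, E)) 𝓘(ℝ, F) ∞ (Function.uncurry Φ) (x, q))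
    {K : Set G} (hK : IsCompact K)
    (hsupp : ∀ x ∈ Metric.closedBall (0 : P) r, ∀ q ∉ K, Φ x q = 0) :
    ∃ L : P →L[ℝ] F, HasFDerivAt (fun x => ∫ q, Φ x q ∂m) L 0 ∧
      ∀ Y, L Y = ∫ q, fderiv ℝ (fun x => Φ x q) 0 Y ∂m := by
  have := FiniteDimensional.proper ℝ P
  set D : P → G → P →L[ℝ] F := fun x q => fderiv ℝ (fun y => Φ y q) x with hD
  have hcont : ContinuousOn (Function.uncurry D) (Metric.closedBall (0 : P) r ×ˢ K) := by
    rintro ⟨x, q⟩ ⟨hx, -⟩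
    exact (continuousAt_fderiv_of_contMDiffAt (hΦ x hx q)).continuousWithinAt
  obtain ⟨C, hC⟩ := ((isCompact_closedBall (0 : P) r).prod hK).exists_bound_of_continuousOn hcont
  have h0 : (0 : P) ∈ Metric.closedBall (0 : P) r := Metric.mem_closedBall_self hr.le
  have hΦc (x : P) (hx : x ∈ Metric.closedBall (0 : P) r) : Continuous (Φ x) :=
    continuous_iff_continuousAt.2 fun q =>
      ContinuousAt.comp (g := Function.uncurry Φ) (f := fun q => (x, q)) (x := q)
        (hΦ x hx q).continuousAt (by fun_prop)
  have hΦi (x : P) (hx : x ∈ Metric.closedBall (0 : P) r) : Integrable (Φ x) m :=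
    (hΦc x hx).integrable_of_hasCompactSupport (HasCompactSupport.intro hK (hsupp x hx))
  have hD0 : ∀ x ∈ Metric.ball (0 : P) r, ∀ q ∉ K, D x q = 0 := by
    intro x hx q hq
    have h : (fun y => Φ y q) =ᶠ[𝓝 x] fun _ => 0 := by
      filter_upwards [Metric.isOpen_ball.mem_nhds hx] with y hy
      exact hsupp y (Metric.ball_subset_closedBall hy) q hq
    rw [hD]
    simp [h.fderiv_eq]
  have hDc : Continuous (D 0) :=
    continuous_iff_continuousAt.2 fun q =>
      ContinuousAt.comp (g := fun p : P × G => D p.1 p.2) (f := fun q => ((0 : P), q)) (x := q)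
        (continuousAt_fderiv_of_contMDiffAt (hΦ 0 h0 q)) (by fun_prop)
  have hDi : Integrable (D 0) m :=
    hDc.integrable_of_hasCompactSupport
      (HasCompactSupport.intro hK (hD0 0 (Metric.mem_ball_self hr)))
  refine ⟨∫ q, D 0 q ∂m, ?_, fun Y => ContinuousLinearMap.integral_apply hDi Y⟩
  refine hasFDerivAt_integral_of_dominated_of_fderiv_le (𝕜 := ℝ) (F' := D)
    (bound := K.indicator fun _ => C)
    (Metric.ball_mem_nhds (0 : P) hr) ?_ (hΦi 0 h0) hDc.aestronglyMeasurable ?_ ?_ ?_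
  · filter_upwards [Metric.closedBall_mem_nhds (0 : P) hr] with x hx
    exact (hΦc x hx).aestronglyMeasurable
  · refine Filter.Eventually.of_forall fun q x hx => ?_
    by_cases hq : q ∈ K
    · rw [Set.indicator_of_mem hq]
      exact hC (x, q) ⟨Metric.ball_subset_closedBall hx, hq⟩
    · rw [Set.indicator_of_notMem hq, hD0 x hx q hq, norm_zero]
  · exact (integrable_indicator_iff hK.measurableSet).2 (integrableOn_const hK.measure_lt_top.ne)
  · refine Filter.Eventually.of_forall fun q x hx => ?_
    have h1 : ContMDiffAt 𝓘(ℝ, P) 𝓘(ℝ, F) ∞ (fun y => Φ y q) x :=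
      ContMDiffAt.comp (g := Function.uncurry Φ) x (hΦ x (Metric.ball_subset_closedBall hx) q)
        (contMDiffAt_id.prodMk contMDiffAt_const)
    exact (h1.contDiffAt.differentiableAt (by simp)).hasFDerivAt

end Integral

lemma _root_.Module.Basis.clm_apply_eq_sum_repr {ι E : Type*} [Fintype ι] [NormedAddCommGroup E]
    [NormedSpace ℝ E] (b : Module.Basis ι ℝ E) (L : E →L[ℝ] ℝ) (v : E) :
    L v = ∑ i, b.repr v i * L (b i) := by
  calc L v = L (∑ i, b.repr v i • b i) := by rw [b.sum_repr]
    _ = _ := by simp only [map_sum, map_smul, smul_eq_mul]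

/-! ### Divergence of left-invariant fields for the left Haar measure -/

section Haar

variable {E : Type*} [NormedAddCommGroup E] [NormedSpace ℝ E] [FiniteDimensional ℝ E]
variable {G : Type*} [TopologicalSpace G] [ChartedSpace E G] [Group G] [LieGroup 𝓘(ℝ, E) ∞ G]
variable [MeasurableSpace G] [BorelSpace G] [SecondCountableTopology G] [T2Space G]
variable {F : Type*} [NormedAddCommGroup F] [NormedSpace ℝ F]

omit [FiniteDimensional ℝ E] [MeasurableSpace G] [BorelSpace G] [SecondCountableTopology G]
  [T2Space G] in
lemma exists_closedBall_contMDiffAt_unitChart :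
    ∃ r > 0, ∀ x ∈ Metric.closedBall (0 : E) r,
      ContMDiffAt 𝓘(ℝ, E) 𝓘(ℝ, E) ∞ (unitChart G : E → G) x := by
  have h : ∀ᶠ x in 𝓝 (0 : E), ContMDiffAt 𝓘(ℝ, E) 𝓘(ℝ, E) ∞ (unitChart G : E → G) x := by
    have : IsManifold 𝓘(ℝ, E) ∞ G := inferInstance
    filter_upwards [eventually_add_mem_target (E := E) (G := G)] with x hx
    exact ContMDiffAt.comp (g := (extChartAt 𝓘(ℝ, E) (1 : G)).symm)
      (f := fun x : E => extChartAt 𝓘(ℝ, E) (1 : G) 1 + x) x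
      ((contMDiffOn_extChartAt_symm (1 : G)).contMDiffAt
        ((isOpen_extChartAt_target (1 : G)).mem_nhds hx))
      (contDiff_const.add contDiff_id).contMDiff.contMDiffAt
  obtain ⟨r, hr, h⟩ := Metric.eventually_nhds_iff_ball.1 h
  exact ⟨r / 2, by positivity, fun x hx => h x (Metric.closedBall_subset_ball (by linarith) hx)⟩

open Pointwise in
-- All right translates of h by elements of a compact neighbourhood K of 1 are supported in supp h ·
-- K⁻¹, so the integral may be differentiated under the integral sign.
lemma hasFDerivAt_integral_mul_unitChart (m : Measure G) [IsFiniteMeasureOnCompacts m]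
    {h : G → F} (hh : ContMDiff 𝓘(ℝ, E) 𝓘(ℝ, F) ∞ h) (hc : HasCompactSupport h) :
    ∃ L : E →L[ℝ] F, HasFDerivAt (fun x : E => ∫ q, h (q * unitChart G x) ∂m) L 0 ∧
      ∀ Y, L Y = ∫ q, leftFDeriv h q Y ∂m := by
  have : IsTopologicalGroup G := topologicalGroup_of_lieGroup 𝓘(ℝ, E) ∞
  have := FiniteDimensional.proper ℝ E
  obtain ⟨r, hr, hκ⟩ := exists_closedBall_contMDiffAt_unitChart (E := E) (G := G)
  have hcomp : IsCompact (unitChart G '' Metric.closedBall (0 : E) r) :=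
    (isCompact_closedBall _ _).image_of_continuousOn
      fun x hx => (hκ x hx).continuousAt.continuousWithinAt
  obtain ⟨L, hL, hLY⟩ := exists_hasFDerivAt_integral (E := E) m
    (Φ := fun x q => h (q * unitChart G x)) hr
    (fun x hx q => ContMDiffAt.comp (g := h) (x, q) hh.contMDiffAt
      (contMDiffAt_snd.mul (ContMDiffAt.comp (g := unitChart G) (x, q) (hκ x hx) contMDiffAt_fst)))
    (K := tsupport h * (unitChart G '' Metric.closedBall (0 : E) r)⁻¹)
    (hc.mul hcomp.inv) (fun x hx q hq => by
      by_contra hne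
      refine hq ⟨q * unitChart G x, subset_tsupport _ hne, (unitChart G x)⁻¹, ?_, by simp⟩
      exact Set.inv_mem_inv.2 ⟨x, hx, rfl⟩)
  refine ⟨L, hL, fun Y => ?_⟩
  rw [hLY]
  simp only [(hasFDerivAt_mul_unitChart hh _).fderiv]

open Pointwise in
lemma hasFDerivAt_integral_unitChart_mul (m : Measure G) [IsFiniteMeasureOnCompacts m]
    {h : G → F} (hh : ContMDiff 𝓘(ℝ, E) 𝓘(ℝ, F) ∞ h) (hc : HasCompactSupport h) :
    ∃ L : E →L[ℝ] F, HasFDerivAt (fun x : E => ∫ q, h (unitChart G x * q) ∂m) L 0 ∧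
      ∀ Y, L Y = ∫ q, leftFDeriv h q (conjFDeriv q Y) ∂m := by
  have : IsTopologicalGroup G := topologicalGroup_of_lieGroup 𝓘(ℝ, E) ∞
  have := FiniteDimensional.proper ℝ E
  obtain ⟨r, hr, hκ⟩ := exists_closedBall_contMDiffAt_unitChart (E := E) (G := G)
  have hcomp : IsCompact (unitChart G '' Metric.closedBall (0 : E) r) :=
    (isCompact_closedBall _ _).image_of_continuousOn
      fun x hx => (hκ x hx).continuousAt.continuousWithinAt
  obtain ⟨L, hL, hLY⟩ := exists_hasFDerivAt_integral (E := E) m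
    (Φ := fun x q => h (unitChart G x * q)) hr
    (fun x hx q => ContMDiffAt.comp (g := h) (x, q) hh.contMDiffAt
      ((ContMDiffAt.comp (g := unitChart G) (x, q) (hκ x hx) contMDiffAt_fst).mul contMDiffAt_snd))
    (K := (unitChart G '' Metric.closedBall (0 : E) r)⁻¹ * tsupport h)
    (hcomp.inv.mul hc) (fun x hx q hq => by
      by_contra hne
      refine hq ⟨(unitChart G x)⁻¹, ?_, unitChart G x * q, subset_tsupport _ hne, by simp⟩
      exact Set.inv_mem_inv.2 ⟨x, hx, rfl⟩)
  refine ⟨L, hL, fun Y => ?_⟩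
  rw [hLY]
  simp only [(hasFDerivAt_comp_mul_right hh unitChart_zero hasMFDerivAt_unitChart _).fderiv]
  rfl

/-- Left invariance of the Haar measure, in infinitesimal form. -/
lemma integral_leftFDeriv_conjFDeriv (m : Measure G) [m.IsHaarMeasure]
    {h : G → F} (hh : ContMDiff 𝓘(ℝ, E) 𝓘(ℝ, F) ∞ h) (hc : HasCompactSupport h) (X : E) :
    ∫ q, leftFDeriv h q (conjFDeriv q X) ∂m = 0 := by
  have : IsTopologicalGroup G := topologicalGroup_of_lieGroup 𝓘(ℝ, E) ∞
  obtain ⟨L, hL, hLY⟩ := hasFDerivAt_integral_unitChart_mul (E := E) m hh hc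
  simp only [integral_mul_left_eq_self] at hL
  rw [← hLY, hL.unique (hasFDerivAt_const _ _)]
  rfl

lemma integral_mul_right_eq_modularCharacterFun_smul [IsTopologicalGroup G] [LocallyCompactSpace G]
    (m : Measure G) [m.IsHaarMeasure] (h : G → F) (g : G) :
    ∫ q, h (q * g) ∂m = (Measure.modularCharacterFun g : ℝ) • ∫ q, h q ∂m := by
  have : SigmaCompactSpace G := inferInstance
  have : T3Space G := inferInstance
  -- The transformation rule under right translations is applied with an inner regular measure; this
  -- regularity follows from σ-compactness and metrizability.
  let _ : MetricSpace G := TopologicalSpace.metrizableSpaceMetric G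
  have : m.InnerRegular := inferInstance
  have h1 := (MeasurableEquiv.mulRight g).measurableEmbedding.integral_map (μ := m) h
  have h2 : Measure.map (MeasurableEquiv.mulRight g) m =
      Measure.modularCharacterFun g • m :=
    Measure.map_right_mul_eq_modularCharacterFun_smul m g
  rw [h2, integral_smul_nnreal_measure] at h1
  exact h1.symm

variable (E) in
omit [SecondCountableTopology G] in
lemma exists_contMDiff_integral_ne_zero (m : Measure G) [m.IsHaarMeasure] :
    ∃ h : G → ℝ, ContMDiff 𝓘(ℝ, E) 𝓘(ℝ, ℝ) ∞ h ∧ HasCompactSupport h ∧ ∫ q, h q ∂m ≠ 0 := by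
  obtain ⟨b⟩ : Nonempty (SmoothBumpFunction 𝓘(ℝ, E) (1 : G)) := inferInstance
  refine ⟨b, b.contMDiff, b.hasCompactSupport, ne_of_gt ?_⟩
  exact b.continuous.integral_pos_of_hasCompactSupport_nonneg_nonzero b.hasCompactSupport
    (fun q => b.nonneg) (x := 1) (by simp)

/-- Right quasi-invariance of the Haar measure, in infinitesimal form. -/
lemma exists_integral_leftFDeriv_eq (m : Measure G) [m.IsHaarMeasure] :
    ∃ c : E →L[ℝ] ℝ, ∀ (F : Type) [NormedAddCommGroup F] [NormedSpace ℝ F] (h : G → F),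
      ContMDiff 𝓘(ℝ, E) 𝓘(ℝ, F) ∞ h → HasCompactSupport h →
      ∀ X : E, ∫ q, leftFDeriv h q X ∂m = c X • ∫ q, h q ∂m := by
  have : IsTopologicalGroup G := topologicalGroup_of_lieGroup 𝓘(ℝ, E) ∞
  have : LocallyCompactSpace G := Manifold.locallyCompact_of_finiteDimensional 𝓘(ℝ, E)
  -- Nothing is assumed on the smoothness of the modular character. It is the quotient of ∫ h₀(q g)
  -- dm by ∫ h₀ dm, hence differentiable at the unit along `unitChart`.
  obtain ⟨h₀, hh₀, hc₀, hi₀⟩ := exists_contMDiff_integral_ne_zero E m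
  obtain ⟨L₀, hL₀, -⟩ := hasFDerivAt_integral_mul_unitChart m hh₀ hc₀
  simp only [integral_mul_right_eq_modularCharacterFun_smul, smul_eq_mul] at hL₀
  have hd := hL₀.mul_const (∫ q, h₀ q ∂m)⁻¹
  simp only [mul_inv_cancel_right₀ hi₀] at hd
  refine ⟨(∫ q, h₀ q ∂m)⁻¹ • L₀, fun F _ _ h hh hc X => ?_⟩
  obtain ⟨L, hL, hLY⟩ := hasFDerivAt_integral_mul_unitChart m hh hc
  simp only [integral_mul_right_eq_modularCharacterFun_smul] at hL
  rw [← hLY, hL.unique (hd.smul_const (∫ q, h q ∂m))]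
  rfl

omit [FiniteDimensional ℝ E] [MeasurableSpace G] [BorelSpace G] [SecondCountableTopology G]
  [T2Space G] in
lemma hasCompactSupport_leftFDeriv {h : G → F} (hh : ContMDiff 𝓘(ℝ, E) 𝓘(ℝ, F) ∞ h)
    (hc : HasCompactSupport h) : HasCompactSupport (leftFDeriv h : G → E →L[ℝ] F) := by
  have : IsTopologicalGroup G := topologicalGroup_of_lieGroup 𝓘(ℝ, E) ∞
  refine hc.mono' fun q hq => ?_
  by_contra hne
  refine hq ((hasFDerivAt_mul_unitChart hh q).unique ?_)
  refine (hasFDerivAt_const (0 : F) (0 : E)).congr_of_eventuallyEq ?_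
  have hcont : Filter.Tendsto (fun x : E => q * unitChart G x) (𝓝 0) (𝓝 q) := by
    have h := (continuous_const_mul q).continuousAt.comp
      (contMDiffAt_unitChart (E := E) (G := G)).continuousAt
    simpa [ContinuousAt, Function.comp_def] using h
  exact hcont.eventually (notMem_tsupport_iff_eventuallyEq.1 hne)

omit [FiniteDimensional ℝ E] [SecondCountableTopology G] [T2Space G] in
-- Integration by parts: the hypothesis applied to the product a g, which has compact support as
-- soon as g has.
lemma integral_smul_leftFDeriv (m : Measure G) [m.IsHaarMeasure] {c : E →L[ℝ] ℝ}
    (hcF : ∀ (h : G → ℝ), ContMDiff 𝓘(ℝ, E) 𝓘(ℝ, ℝ) ∞ h → HasCompactSupport h →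
      ∀ X : E, ∫ q, leftFDeriv h q X ∂m = c X • ∫ q, h q ∂m)
    {a g : G → ℝ} (ha : ContMDiff 𝓘(ℝ, E) 𝓘(ℝ, ℝ) ∞ a) (hg : ContMDiff 𝓘(ℝ, E) 𝓘(ℝ, ℝ) ∞ g)
    (hgc : HasCompactSupport g) (X : E) :
    Integrable (fun q => a q * leftFDeriv g q X) m ∧
    Integrable (fun q => (c X * a q - leftFDeriv a q X) * g q) m ∧
    ∫ q, a q * leftFDeriv g q X ∂m = ∫ q, (c X * a q - leftFDeriv a q X) * g q ∂m := by
  have hda : Continuous fun q => leftFDeriv a q X :=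
    ((contMDiff_leftFDeriv ha).clm_apply (contMDiff_const (c := X))).continuous
  have hdg : Continuous fun q => leftFDeriv g q X :=
    ((contMDiff_leftFDeriv hg).clm_apply (contMDiff_const (c := X))).continuous
  have hi1 : Integrable (fun q => leftFDeriv a q X * g q) m :=
    (hda.mul hg.continuous).integrable_of_hasCompactSupport
      (hgc.mono fun q hq => right_ne_zero_of_mul hq)
  have hi2 : Integrable (fun q => c X * a q * g q) m :=
    ((ha.continuous.const_mul _).mul hg.continuous).integrable_of_hasCompactSupport
      (hgc.mono fun q hq => right_ne_zero_of_mul hq)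
  have hi3 : Integrable (fun q => a q * leftFDeriv g q X) m :=
    (ha.continuous.mul hdg).integrable_of_hasCompactSupport
      ((hasCompactSupport_leftFDeriv hg hgc).mono fun q hq h0 => hq (by
        change a q * leftFDeriv g q X = 0
        rw [show leftFDeriv g q = 0 from h0]
        simp))
  have h3 := hcF (fun q => a q • g q) (ha.smul hg)
    (hgc.mono fun q hq => right_ne_zero_of_mul hq) X
  simp only [leftFDeriv_smul ha hg] at h3
  simp only [smul_eq_mul] at h3
  rw [integral_add hi1 hi3, ← integral_const_mul] at h3
  simp only [sub_mul]
  refine ⟨hi3, hi2.sub hi1, ?_⟩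
  rw [integral_sub hi2 hi1]
  simp only [mul_assoc]
  linarith

lemma integral_leftFDeriv_eq_zero_of_isMulRightInvariant (m : Measure G) [m.IsHaarMeasure]
    [m.IsMulRightInvariant] {h : G → F} (hh : ContMDiff 𝓘(ℝ, E) 𝓘(ℝ, F) ∞ h)
    (hc : HasCompactSupport h) (X : E) : ∫ q, leftFDeriv h q X ∂m = 0 := by
  have : IsTopologicalGroup G := topologicalGroup_of_lieGroup 𝓘(ℝ, E) ∞
  obtain ⟨L, hL, hLY⟩ := hasFDerivAt_integral_mul_unitChart (E := E) m hh hc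
  simp only [integral_mul_right_eq_self] at hL
  rw [← hLY, hL.unique (hasFDerivAt_const _ _)]
  rfl

/-- The divergence of a left-invariant vector field with respect to the left Haar measure. -/
lemma integral_leftFDeriv_eq_trace_ad (m : Measure G) [m.IsHaarMeasure] {F : Type}
    [NormedAddCommGroup F] [NormedSpace ℝ F] {h : G → F}
    (hh : ContMDiff 𝓘(ℝ, E) 𝓘(ℝ, F) ∞ h) (hc : HasCompactSupport h) (X : E) :
    ∫ q, leftFDeriv h q X ∂m = LinearMap.trace ℝ E (ad G X) • ∫ q, h q ∂m := by
  have : IsTopologicalGroup G := topologicalGroup_of_lieGroup 𝓘(ℝ, E) ∞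
  have : LocallyCompactSpace G := Manifold.locallyCompact_of_finiteDimensional 𝓘(ℝ, E)
  obtain ⟨c, hcF⟩ := exists_integral_leftFDeriv_eq (E := E) m
  suffices hcX : c X = LinearMap.trace ℝ E (ad G X) by rw [← hcX]; exact hcF F h hh hc X
  set b := Module.finBasis ℝ E
  set coord : Fin (Module.finrank ℝ E) → E →L[ℝ] ℝ := fun i =>
    LinearMap.toContinuousLinearMap (b.coord i) with hcoord
  -- Coefficients of the right-invariant field of X in the left-invariant frame `b`.
  set a : Fin (Module.finrank ℝ E) → G → ℝ := fun i q => coord i (conjFDeriv q X) with ha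
  have haS (i) : ContMDiff 𝓘(ℝ, E) 𝓘(ℝ, ℝ) ∞ (a i) :=
    (coord i).contMDiff.comp (contMDiff_conjFDeriv.clm_apply (contMDiff_const (c := X)))
  set u : G → ℝ := fun q => ∑ i, (c (b i) * a i q - leftFDeriv (a i) q (b i)) with hu
  have huc : Continuous u := continuous_finsetSum _ fun i _ =>
    (continuous_const.mul (haS i).continuous).sub
      (((contMDiff_leftFDeriv (haS i)).clm_apply (contMDiff_const (c := b i))).continuous)
  -- Integrating by parts in ∫ ∑ aᵢ L_{bᵢ} g = 0, valid for every test function g, leaves ∫ u g = 0.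
  have hu0 : ∀ᵐ q ∂m, u q = 0 := by
    refine ae_eq_zero_of_integral_contMDiff_smul_eq_zero 𝓘(ℝ, E) huc.locallyIntegrable ?_
    intro g hg hgc
    have h0 := integral_leftFDeriv_conjFDeriv m hg hgc X
    have h1 (i) := integral_smul_leftFDeriv m (hcF ℝ) (haS i) hg hgc (b i)
    have h4 (q) : leftFDeriv g q (conjFDeriv q X) = ∑ i, a i q * leftFDeriv g q (b i) := by
      rw [b.clm_apply_eq_sum_repr]
      rfl
    simp only [h4] at h0
    rw [integral_finsetSum _ fun i _ => (h1 i).1] at h0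
    simp only [fun i => (h1 i).2.2] at h0
    rw [← integral_finsetSum _ fun i _ => (h1 i).2.1] at h0
    rw [← h0]
    congr 1
    ext q
    rw [hu, smul_eq_mul, mul_comm, Finset.sum_mul]
  have hu1 : u 1 = 0 := by
    -- Haar measure charges every nonempty open set, so a continuous function vanishing almost
    -- everywhere vanishes at 1.
    have h := (huc.ae_eq_iff_eq m continuous_const).1 hu0
    exact congrFun h 1
  have hA : ContMDiff 𝓘(ℝ, E) 𝓘(ℝ, E) ∞ (fun q : G => conjFDeriv q X) :=
    contMDiff_conjFDeriv.clm_apply contMDiff_const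
  simp only [hu, Finset.sum_sub_distrib, ha, leftFDeriv_clm_comp _ hA, leftFDeriv_conjFDeriv_one,
    conjFDeriv_one, ContinuousLinearMap.id_apply] at hu1
  have h5 : c X = ∑ i, c (b i) * coord i X := by
    rw [b.clm_apply_eq_sum_repr c X]
    exact Finset.sum_congr rfl fun i _ => mul_comm _ _
  rw [h5, sub_eq_zero.1 hu1, LinearMap.trace_eq_matrix_trace ℝ b, Matrix.trace]
  refine Finset.sum_congr rfl fun i _ => ?_
  rw [Matrix.diag_apply, LinearMap.toMatrix_apply]
  rfl

omit [MeasurableSpace G] [BorelSpace G] [SecondCountableTopology G] [T2Space G] in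
lemma trace_ad_eq_sum_structureConst {ι : Type*} [Fintype ι] (X : Module.Basis ι ℝ E) (j : ι) :
    LinearMap.trace ℝ E (ad G (X j)) = ∑ k, structureConst G X k j k := by
  classical
  rw [LinearMap.trace_eq_matrix_trace ℝ X, Matrix.trace]
  refine Finset.sum_congr rfl fun i _ => ?_
  rw [Matrix.diag_apply, LinearMap.toMatrix_apply]
  rfl

/-- Compare the divergence formula with the vanishing of ∫ L_X h for a function of nonzero integral.
-/
lemma trace_ad_eq_zero_of_isMulRightInvariant (m : Measure G) [m.IsHaarMeasure]
    [m.IsMulRightInvariant] (X : E) : LinearMap.trace ℝ E (ad G X) = 0 := by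
  obtain ⟨h₀, hh₀, hc₀, hi₀⟩ := exists_contMDiff_integral_ne_zero E m
  have h1 := integral_leftFDeriv_eq_trace_ad m hh₀ hc₀ X
  rw [integral_leftFDeriv_eq_zero_of_isMulRightInvariant m hh₀ hc₀, smul_eq_mul] at h1
  exact (mul_eq_zero.1 h1.symm).resolve_right hi₀

end Haar

/-! ### The exponential map -/

section Exp

variable {E : Type*} [NormedAddCommGroup E] [NormedSpace ℝ E]
variable {G : Type*} [TopologicalSpace G] [ChartedSpace E G] [Group G] [LieGroup 𝓘(ℝ, E) ∞ G]

lemma mfderiv_mul_left_mulInvariantVectorField (X : E) (q g : G) :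
    mfderiv 𝓘(ℝ, E) 𝓘(ℝ, E) (fun y => q * y) g
      (mulInvariantVectorField (X : GroupLieAlgebra 𝓘(ℝ, E) G) g) =
      mulInvariantVectorField (X : GroupLieAlgebra 𝓘(ℝ, E) G) (q * g) := by
  have h := mfderiv_comp_of_eq (I := 𝓘(ℝ, E)) (I' := 𝓘(ℝ, E)) (I'' := 𝓘(ℝ, E)) (x := (1 : G))
    (g := fun y => q * y) (f := fun y => g * y) (y := g) (mdifferentiableAt_mul_left q g)
    (mdifferentiableAt_mul_left g 1) (by simp)
  have h1 : (fun y => q * y) ∘ (fun y => g * y) = fun y : G => q * g * y :=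
    funext fun y => (mul_assoc q g y).symm
  rw [h1] at h
  have h2 : ∀ g', g' = g → (mfderiv 𝓘(ℝ, E) 𝓘(ℝ, E) (fun y => q * y) g : E →L[ℝ] E) =
    mfderiv 𝓘(ℝ, E) 𝓘(ℝ, E) (fun y => q * y) g' := by rintro _ rfl; rfl
  refine Eq.trans ?_ (DFunLike.congr_fun h X).symm
  exact DFunLike.congr_fun (h2 (g * 1) (mul_one g)) _

lemma IsMIntegralCurveOn.mul_left {X : E} {γ : ℝ → G} {s : Set ℝ}
    (hγ : IsMIntegralCurveOn (I := 𝓘(ℝ, E)) γ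
      (mulInvariantVectorField (X : GroupLieAlgebra 𝓘(ℝ, E) G)) s) (q : G) :
    IsMIntegralCurveOn (I := 𝓘(ℝ, E)) (fun t => q * γ t)
      (mulInvariantVectorField (X : GroupLieAlgebra 𝓘(ℝ, E) G)) s := by
  intro t ht
  have h := (mdifferentiableAt_mul_left q (γ t)).hasMFDerivAt.comp_hasMFDerivWithinAt t (hγ t ht)
  rw [← mfderiv_mul_left_mulInvariantVectorField]
  have e : ∀ (A : E →L[ℝ] E) (v : E), ContinuousLinearMap.smulRight (1 : ℝ →L[ℝ] ℝ) (A v) =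
      A.comp (ContinuousLinearMap.smulRight (1 : ℝ →L[ℝ] ℝ) v) := fun A v => by ext; simp
  exact (e _ _).symm ▸ h

lemma contMDiff_one_mulInvariantVectorField (X : E) :
    ContMDiff 𝓘(ℝ, E) 𝓘(ℝ, E).tangent 1 (fun g : G =>
      (⟨g, mulInvariantVectorField (X : GroupLieAlgebra 𝓘(ℝ, E) G) g⟩ :
        TangentBundle 𝓘(ℝ, E) G)) :=
  (contMDiff_mulInvariantVectorField (I := 𝓘(ℝ, E)) (G := G) X).of_le (by
    rw [minSmoothness_of_isRCLikeNormedField]; norm_num)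

variable [FiniteDimensional ℝ E] [T2Space G]

/-- Left translates of one local integral curve through 1 give curves through all points with a
common time of existence, and this uniformity forces completeness. -/
lemma exists_isMIntegralCurve_mulInvariantVectorField (X : E) :
    ∃ γ : ℝ → G, γ 0 = 1 ∧ IsMIntegralCurve (I := 𝓘(ℝ, E)) γ
        (mulInvariantVectorField (X : GroupLieAlgebra 𝓘(ℝ, E) G)) := by
  have := FiniteDimensional.complete ℝ E
  have : IsManifold 𝓘(ℝ, E) 1 G := IsManifold.of_le (n := ∞) ENat.LEInfty.out
  have hX := contMDiff_one_mulInvariantVectorField (G := G) X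
  obtain ⟨γ, hγ0, hγ⟩ := exists_isMIntegralCurveAt_of_contMDiffAt_boundaryless
    (I := 𝓘(ℝ, E)) (t₀ := 0) (x₀ := (1 : G)) hX.contMDiffAt
  obtain ⟨ε, hε, h⟩ := isMIntegralCurveAt_iff'.1 hγ
  refine exists_isMIntegralCurve_of_isMIntegralCurveOn hX hε (fun q => ⟨fun t => q * γ t, ?_, ?_⟩) 1
  · simp [hγ0]
  · rw [Real.ball_eq_Ioo, zero_sub, zero_add] at h
    exact IsMIntegralCurveOn.mul_left h q

variable (G) in
/-- The one-parameter group of `X`. -/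
def expCurve (X : E) : ℝ → G := (exists_isMIntegralCurve_mulInvariantVectorField X).choose

lemma expCurve_zero (X : E) : expCurve G X 0 = 1 :=
  (exists_isMIntegralCurve_mulInvariantVectorField X).choose_spec.1

lemma isMIntegralCurve_expCurve (X : E) : IsMIntegralCurve (I := 𝓘(ℝ, E)) (expCurve G X)
    (mulInvariantVectorField (X : GroupLieAlgebra 𝓘(ℝ, E) G)) :=
  (exists_isMIntegralCurve_mulInvariantVectorField X).choose_spec.2

lemma eq_of_isMIntegralCurve {X : E} {γ γ' : ℝ → G}
    (hγ : IsMIntegralCurve (I := 𝓘(ℝ, E)) γ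
      (mulInvariantVectorField (X : GroupLieAlgebra 𝓘(ℝ, E) G)))
    (hγ' : IsMIntegralCurve (I := 𝓘(ℝ, E)) γ'
      (mulInvariantVectorField (X : GroupLieAlgebra 𝓘(ℝ, E) G))) (h0 : γ 0 = γ' 0) : γ = γ' := by
  have := FiniteDimensional.complete ℝ E
  have : IsManifold 𝓘(ℝ, E) 1 G := IsManifold.of_le (n := ∞) ENat.LEInfty.out
  exact isMIntegralCurve_Ioo_eq_of_contMDiff_boundaryless (t₀ := 0)
    (contMDiff_one_mulInvariantVectorField (G := G) X) hγ hγ' h0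

lemma lieExp_eq_expCurve (X : E) : lieExp G X = expCurve G X 1 := by
  have h := exists_isMIntegralCurve_mulInvariantVectorField (G := G) X
  rw [lieExp, dif_pos h]
  rfl

lemma expCurve_smul (X : E) (s t : ℝ) : expCurve G (s • X) t = expCurve G X (t * s) := by
  have h := (isMIntegralCurve_expCurve (G := G) X).comp_mul s
  have h : IsMIntegralCurve (I := 𝓘(ℝ, E)) (expCurve G X ∘ fun x => x * s)
      (mulInvariantVectorField (s • X : GroupLieAlgebra 𝓘(ℝ, E) G)) := by
    convert h using 1
    exact mulInvariantVectorField_smul (I := 𝓘(ℝ, E)) (G := G) s X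
  exact congrFun (eq_of_isMIntegralCurve (isMIntegralCurve_expCurve (G := G) (s • X)) h
    (by simp [expCurve_zero])) t

lemma expCurve_eq_lieExp (X : E) (t : ℝ) : expCurve G X t = lieExp G (t • X) := by
  rw [lieExp_eq_expCurve, expCurve_smul, one_mul]

lemma lieExp_zero : lieExp G (0 : E) = 1 := by
  rw [← expCurve_zero (0 : E), expCurve_eq_lieExp, smul_zero]

/-- A time shift and a left translate of the one-parameter group are integral curves with the same
initial value. -/
lemma lieExp_add_smul (X : E) (s t : ℝ) :
    lieExp G ((s + t) • X) = lieExp G (s • X) * lieExp G (t • X) := by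
  have h1 := (isMIntegralCurve_expCurve (G := G) X).comp_add s
  have h2 : IsMIntegralCurve (I := 𝓘(ℝ, E)) (fun t => expCurve G X s * expCurve G X t)
      (mulInvariantVectorField (X : GroupLieAlgebra 𝓘(ℝ, E) G)) := by
    rw [isMIntegralCurve_iff_isMIntegralCurveOn]
    exact IsMIntegralCurveOn.mul_left ((isMIntegralCurve_expCurve X).isMIntegralCurveOn _) _
  have h3 := congrFun (eq_of_isMIntegralCurve h1 h2 (by simp [expCurve_zero])) t
  simp only [Function.comp_apply, expCurve_eq_lieExp] at h3
  rw [← h3, add_comm]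

lemma lieExp_nsmul (n : ℕ) (X : E) : lieExp G ((n : ℝ) • X) = lieExp G X ^ n := by
  induction n with
  | zero => simp [lieExp_zero]
  | succ n ih => rw [Nat.cast_succ, lieExp_add_smul, ih, one_smul, pow_succ]

lemma hasMFDerivAt_lieExp {𝒪 : Set E} (h𝒪 : IsOpen 𝒪) (h0 : 0 ∈ 𝒪)
    (hexp : ContMDiffOn 𝓘(ℝ, E) 𝓘(ℝ, E) ∞ (lieExp G) 𝒪) :
    HasMFDerivAt 𝓘(ℝ, E) 𝓘(ℝ, E) (lieExp G) (0 : E) (ContinuousLinearMap.id ℝ E) := by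
  have h1 : MDifferentiableAt 𝓘(ℝ, E) 𝓘(ℝ, E) (lieExp G) (0 : E) :=
    (hexp.contMDiffAt (h𝒪.mem_nhds h0)).mdifferentiableAt (by simp)
  -- The curve t ↦ tX has the value `0 • X` at time 0, equal to 0 only propositionally; the base
  -- point is therefore kept free.
  have h1' : ∀ y : E, y = 0 → HasMFDerivAt 𝓘(ℝ, E) 𝓘(ℝ, E) (lieExp G) y
      (mfderiv 𝓘(ℝ, E) 𝓘(ℝ, E) (lieExp G) (0 : E) : E →L[ℝ] E) := by
    rintro _ rfl
    exact h1.hasMFDerivAt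
  suffices h : (mfderiv 𝓘(ℝ, E) 𝓘(ℝ, E) (lieExp G) (0 : E) : E →L[ℝ] E) =
      ContinuousLinearMap.id ℝ E by
    have h2 := h1' 0 rfl
    rwa [h] at h2
  refine ContinuousLinearMap.ext fun (X : E) => ?_
  -- The differential sends X to the velocity of t ↦ exp(tX) at 0, which is X.
  have h2 := isMIntegralCurve_expCurve (G := G) X 0
  have h3 : HasMFDerivAt 𝓘(ℝ, ℝ) 𝓘(ℝ, E) (fun t : ℝ => t • X) 0
      ((1 : ℝ →L[ℝ] ℝ).smulRight X) :=
    ((1 : ℝ →L[ℝ] ℝ).smulRight X).hasFDerivAt.hasMFDerivAt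
  have h4 := (h1' ((0 : ℝ) • X) (zero_smul ℝ X)).comp (0 : ℝ) h3
  have h5 : lieExp G ∘ (fun t : ℝ => t • X) = expCurve G X :=
    funext fun t => (expCurve_eq_lieExp X t).symm
  rw [h5] at h4
  have h6 := DFunLike.congr_fun (hasMFDerivAt_unique h4 h2) (1 : ℝ)
  have h7 := mulInvariantVectorField_eq_of_eq_one (G := G) X (expCurve_zero X)
  rw [h7] at h6
  have e1 : ∀ A : E →L[ℝ] E, A.comp ((1 : ℝ →L[ℝ] ℝ).smulRight X) (1 : ℝ) = A X :=
    fun A => by simp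
  have e2 : ((1 : ℝ →L[ℝ] ℝ).smulRight X) (1 : ℝ) = X := by simp
  exact (e1 _).symm.trans (h6.trans e2)

variable (G) in
/-- A bounded set of the Lie algebra is mapped by `X ↦ exp (t X)` into a compact set. -/
lemma exists_isCompact_lieExp_mem {𝒪 : Set E} (h𝒪 : IsOpen 𝒪) (h0 : 0 ∈ 𝒪)
    (hexp : ContMDiffOn 𝓘(ℝ, E) 𝓘(ℝ, E) ∞ (lieExp G) 𝒪) {B : Set E}
    (hB : Bornology.IsBounded B) : ∃ K : Set G, IsCompact K ∧ ∀ X ∈ B, lieExp G X ∈ K := by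
  have : IsTopologicalGroup G := topologicalGroup_of_lieGroup 𝓘(ℝ, E) ∞
  have := FiniteDimensional.proper ℝ E
  obtain ⟨r, hr, hr𝒪⟩ := Metric.nhds_basis_closedBall.mem_iff.1 (h𝒪.mem_nhds h0)
  have hC : IsCompact (lieExp G '' Metric.closedBall (0 : E) r) :=
    (isCompact_closedBall _ _).image_of_continuousOn (hexp.continuousOn.mono hr𝒪)
  obtain ⟨R, hR⟩ := hB.exists_norm_le
  -- Continuity of exp is at hand only on `𝒪`. With N > R/r the vector X/N lies in the ball of
  -- radius r inside `𝒪`, and exp X = exp(X/N)^N.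
  obtain ⟨N, hN⟩ := exists_nat_gt (R / r)
  have hpow : IsCompact ((fun q : G => q ^ N) '' (lieExp G '' Metric.closedBall (0 : E) r)) :=
    hC.image (continuous_pow N)
  refine ⟨_, hpow, fun X hX => ⟨lieExp G ((N : ℝ)⁻¹ • X), ⟨_, ?_, rfl⟩, ?_⟩⟩
  · have hN0 : 0 ≤ R / r := div_nonneg ((norm_nonneg X).trans (hR X hX)) hr.le
    have hN1 : (0 : ℝ) < N := hN0.trans_lt hN
    rw [mem_closedBall_zero_iff, norm_smul, norm_inv, Real.norm_natCast, inv_mul_le_iff₀ hN1]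
    exact (hR X hX).trans (((div_lt_iff₀ hr).1 hN).le)
  · have hN0 : 0 ≤ R / r := div_nonneg ((norm_nonneg X).trans (hR X hX)) hr.le
    have hN1 : (N : ℝ) ≠ 0 := (hN0.trans_lt hN).ne'
    simp only
    rw [← lieExp_nsmul, smul_inv_smul₀ hN1]

end Exp

/-! ### The factor F to first order at the origin -/

section Jacobian

variable {E : Type*} [NormedAddCommGroup E] [NormedSpace ℝ E]

lemma opNorm_pow_le (A : E →L[ℝ] E) (n : ℕ) : ‖A ^ n‖ ≤ ‖A‖ ^ n := by
  induction n with
  | zero => simpa using! ContinuousLinearMap.norm_id_le (𝕜 := ℝ) (E := E)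
  | succ n ih =>
    rw [pow_succ, pow_succ]
    exact (ContinuousLinearMap.opNorm_comp_le _ _).trans (by gcongr)

/-- The power series of `λ(x) = (2/x) sinh (x/2)`, evaluated at an endomorphism. -/
def sinhcSeries (A : E →L[ℝ] E) : E →L[ℝ] E :=
  ∑' n : ℕ, ((4 : ℝ) ^ n * ((2 * n + 1).factorial : ℝ))⁻¹ • A ^ (2 * n)

/-- Since n! ≤ 4ⁿ (2n+1)!, the exponential series of R² dominates, uniformly on balls. -/
lemma norm_sinhcSeries_term_le {A : E →L[ℝ] E} {R : ℝ} (hA : ‖A‖ ≤ R) (n : ℕ) :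
    ‖((4 : ℝ) ^ n * ((2 * n + 1).factorial : ℝ))⁻¹ • A ^ (2 * n)‖ ≤
      (R ^ 2) ^ n / n.factorial := by
  have h1 : (n.factorial : ℝ) ≤ (4 : ℝ) ^ n * ((2 * n + 1).factorial : ℝ) := by
    have h2 : (n.factorial : ℝ) ≤ ((2 * n + 1).factorial : ℝ) := by
      exact_mod_cast Nat.factorial_le (by omega)
    have h3 : (1 : ℝ) ≤ 4 ^ n := one_le_pow₀ (by norm_num)
    nlinarith [Nat.cast_nonneg (α := ℝ) (2 * n + 1).factorial]
  have h4 : (0 : ℝ) < n.factorial := by exact_mod_cast n.factorial_pos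
  have hR : 0 ≤ R := (norm_nonneg A).trans hA
  rw [norm_smul, norm_inv, Real.norm_of_nonneg (h4.le.trans h1), ← pow_mul, div_eq_inv_mul]
  gcongr
  exact (opNorm_pow_le A _).trans (by gcongr)

lemma summable_sinhcSeries [CompleteSpace E] (A : E →L[ℝ] E) :
    Summable fun n : ℕ => ((4 : ℝ) ^ n * ((2 * n + 1).factorial : ℝ))⁻¹ • A ^ (2 * n) :=
  Summable.of_norm_bounded (Real.summable_pow_div_factorial (‖A‖ ^ 2))
    (norm_sinhcSeries_term_le le_rfl)

lemma continuous_sinhcSeries [CompleteSpace E] :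
    Continuous (sinhcSeries : (E →L[ℝ] E) → E →L[ℝ] E) := by
  refine continuous_iff_continuousAt.2 fun A => ?_
  have h : ContinuousOn (sinhcSeries : (E →L[ℝ] E) → E →L[ℝ] E)
      (Metric.closedBall 0 (‖A‖ + 1)) := by
    refine continuousOn_tsum (fun n => ?_) (Real.summable_pow_div_factorial ((‖A‖ + 1) ^ 2))
      fun n B hB => norm_sinhcSeries_term_le (mem_closedBall_zero_iff.1 hB) n
    have hc : Continuous fun A : E →L[ℝ] E =>
        ((4 : ℝ) ^ n * ((2 * n + 1).factorial : ℝ))⁻¹ • A ^ (2 * n) := by fun_prop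
    exact hc.continuousOn
  refine h.continuousAt (Filter.mem_of_superset (Metric.ball_mem_nhds A one_pos) fun B hB => ?_)
  rw [mem_ball_iff_norm] at hB
  rw [mem_closedBall_zero_iff]
  linarith [norm_le_norm_add_norm_sub' B A]

/-- The series contains only even powers, so after its constant term 1 every term carries a factor
A². -/
lemma norm_sinhcSeries_sub_one_le [CompleteSpace E] {A : E →L[ℝ] E} (hA : ‖A‖ ≤ 1) :
    ‖sinhcSeries A - 1‖ ≤ (∑' n : ℕ, (1 : ℝ) / (n + 1).factorial) * ‖A‖ ^ 2 := by
  have h0 := (summable_sinhcSeries A).tsum_eq_zero_add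
  have hs : Summable fun n : ℕ => (1 : ℝ) / (n + 1).factorial := by
    simpa using (summable_nat_add_iff 1).2 (Real.summable_pow_div_factorial 1)
  have h1 : sinhcSeries A - 1 = ∑' n : ℕ,
      ((4 : ℝ) ^ (n + 1) * ((2 * (n + 1) + 1).factorial : ℝ))⁻¹ • A ^ (2 * (n + 1)) := by
    rw [sinhcSeries, h0]
    simp
  rw [h1, ← tsum_mul_right]
  refine tsum_of_norm_bounded (hs.mul_right _).hasSum fun n => ?_
  refine (norm_sinhcSeries_term_le le_rfl (n + 1)).trans ?_
  rw [pow_succ, mul_div_assoc, div_eq_inv_mul, ← mul_assoc, one_div]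
  gcongr ?_ * _
  have h2 : (‖A‖ ^ 2) ^ n ≤ 1 := pow_le_one₀ (by positivity) (pow_le_one₀ (norm_nonneg _) hA)
  have h3 : (0 : ℝ) ≤ ((n + 1).factorial : ℝ)⁻¹ := by positivity
  nlinarith

lemma differentiable_det [FiniteDimensional ℝ E] :
    Differentiable ℝ fun A : E →L[ℝ] E => A.det := by
  set b := Module.finBasis ℝ E
  have h : (fun A : E →L[ℝ] E => A.det) = fun A : E →L[ℝ] E =>
      Matrix.det (LinearMap.toMatrix b b (A : E →ₗ[ℝ] E)) :=
    funext fun A => (LinearMap.det_toMatrix b (A : E →ₗ[ℝ] E)).symm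
  rw [h]
  have hent (i j) : Differentiable ℝ fun A : E →L[ℝ] E =>
      LinearMap.toMatrix b b (A : E →ₗ[ℝ] E) i j := by
    have h2 : (fun A : E →L[ℝ] E =>
      LinearMap.toMatrix b b (A : E →ₗ[ℝ] E) i j) = fun A =>
        LinearMap.toContinuousLinearMap (b.coord i) (A (b j)) := by
      ext A
      rw [LinearMap.toMatrix_apply]
      rfl
    rw [h2]
    fun_prop
  simp only [Matrix.det_apply]
  fun_prop

variable {G : Type*} [TopologicalSpace G] [ChartedSpace E G] [Group G] [LieGroup 𝓘(ℝ, E) ∞ G]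
variable [FiniteDimensional ℝ E]

variable (G) in
lemma exists_ad_eq_clm : ∃ L : E →L[ℝ] E →L[ℝ] E, ∀ X, L X = ad G X := by
  let L : E →ₗ[ℝ] E →L[ℝ] E :=
    { toFun := ad G
      map_add' := fun X Y => by
        ext Z
        exact add_lie (L := GroupLieAlgebra 𝓘(ℝ, E) G) (M := GroupLieAlgebra 𝓘(ℝ, E) G) X Y Z
      map_smul' := fun c X => by
        ext Z
        exact smul_lie (R := ℝ) (L := GroupLieAlgebra 𝓘(ℝ, E) G)
          (M := GroupLieAlgebra 𝓘(ℝ, E) G) c X Z }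
  exact ⟨LinearMap.toContinuousLinearMap L, fun X => rfl⟩

lemma jacF_eq (X : E) : jacF G X = Real.sqrt |(sinhcSeries (ad G X)).det| := rfl

variable (G) in
lemma continuous_jacF : Continuous (jacF G : E → ℝ) := by
  have := FiniteDimensional.complete ℝ E
  obtain ⟨L, hL⟩ := exists_ad_eq_clm (E := E) G
  have h : (jacF G : E → ℝ) = fun X => Real.sqrt |(sinhcSeries (L X)).det| := by
    ext X
    rw [hL, jacF_eq]
  rw [h]
  exact ((ContinuousLinearMap.continuous_det.comp
    (continuous_sinhcSeries.comp L.continuous)).abs).sqrt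

variable (G) in
-- As λ(ad_X) = 1 + O(‖X‖²), its first differential at 0 vanishes; the determinant, the absolute
-- value and the square root are differentiable near the value 1 and keep it zero.
lemma jacF_zero_and_hasFDerivAt :
    jacF G (0 : E) = 1 ∧ HasFDerivAt (jacF G : E → ℝ) (0 : E →L[ℝ] ℝ) 0 := by
  have := FiniteDimensional.complete ℝ E
  obtain ⟨L, hL⟩ := exists_ad_eq_clm (E := E) G
  have h1 : sinhcSeries (L 0) = 1 := by
    have h := norm_sinhcSeries_sub_one_le (A := L 0) (by simp)
    simpa [sub_eq_zero] using h
  have h2 : HasFDerivAt (fun X => sinhcSeries (L X) - 1) (0 : E →L[ℝ] E →L[ℝ] E) 0 := by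
    refine Asymptotics.IsBigO.hasFDerivAt (n := 2) ?_ (by norm_num)
    have h3 : ∀ᶠ X in 𝓝 (0 : E), ‖L X‖ ≤ 1 := by
      have h4 : Filter.Tendsto (fun X => ‖L X‖) (𝓝 0) (𝓝 0) := by
        simpa using (L.continuous.norm).tendsto 0
      exact (h4.eventually (gt_mem_nhds one_pos)).mono fun X hX => le_of_lt hX
    refine Asymptotics.IsBigO.of_bound ((∑' n : ℕ, (1 : ℝ) / (n + 1).factorial) * ‖L‖ ^ 2) ?_
    filter_upwards [h3] with X hX
    refine (norm_sinhcSeries_sub_one_le hX).trans ?_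
    rw [sub_zero, norm_pow, norm_norm, mul_assoc, ← mul_pow]
    have h5 : (0 : ℝ) ≤ ∑' n : ℕ, (1 : ℝ) / (n + 1).factorial :=
      tsum_nonneg fun n => by positivity
    gcongr
    exact L.le_opNorm X
  have h3 : HasFDerivAt (fun X => sinhcSeries (L X)) (0 : E →L[ℝ] E →L[ℝ] E) 0 := by
    simpa using h2.add_const 1
  have hdet1 : (sinhcSeries (L 0)).det = 1 := by
    rw [h1]
    exact LinearMap.det_id
  have h4 := (differentiable_det (sinhcSeries (L 0))).hasFDerivAt.comp (0 : E) h3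
  have h5 : HasFDerivAt (fun X => |(sinhcSeries (L X)).det|) (0 : E →L[ℝ] ℝ) 0 := by
    have hne : (sinhcSeries (L 0)).det ≠ 0 := by rw [hdet1]; exact one_ne_zero
    have h := h4.abs hne
    simpa using! h
  have h6 := h5.sqrt (by rw [hdet1]; simp)
  refine ⟨?_, ?_⟩
  · rw [jacF_eq, ← hL, hdet1]
    simp
  · have h : (jacF G : E → ℝ) = fun X => Real.sqrt |(sinhcSeries (L X)).det| := by
      ext X
      rw [hL, jacF_eq]
    rw [h]
    simpa using h6

end Jacobian

/-! ### Fourier transforms of dilated cut-offs as approximate delta functions -/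

section Fourier

open FourierTransform

variable {E : Type*} [NormedAddCommGroup E] [NormedSpace ℝ E] [FiniteDimensional ℝ E]

lemma integral_fourier_schwartz {V : Type*} [NormedAddCommGroup V] [InnerProductSpace ℝ V]
    [FiniteDimensional ℝ V] [MeasurableSpace V] [BorelSpace V] (f : SchwartzMap V ℂ) :
    ∫ v, 𝓕 f v = f 0 := by
  have h : 𝓕⁻ (𝓕 f) = f := FourierTransform.fourierInv_fourier_eq f
  have h2 := DFunLike.congr_fun h 0
  rw [SchwartzMap.fourierInv_coe, Real.fourierInv_eq'] at h2
  simpa using h2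

/-- The identification of a space with the dual of another one given by an isomorphism onto a
Euclidean space, normalized so that the pairing is `2π` times the inner product. -/
def dualEquiv {V : Type*} [NormedAddCommGroup V] [InnerProductSpace ℝ V] [FiniteDimensional ℝ V]
    (S : E ≃L[ℝ] V) : V ≃L[ℝ] StrongDual ℝ E :=
  ((ContinuousLinearEquiv.smulLeft (Units.mk0 (2 * Real.pi) (by positivity)) :
      V ≃L[ℝ] V).trans (InnerProductSpace.toDual ℝ V).toContinuousLinearEquiv).trans
    (S.symm.arrowCongr (ContinuousLinearEquiv.refl ℝ ℝ))

omit [FiniteDimensional ℝ E] in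
lemma dualEquiv_apply {V : Type*} [NormedAddCommGroup V] [InnerProductSpace ℝ V]
    [FiniteDimensional ℝ V] (S : E ≃L[ℝ] V) (v : V) (Y : E) :
    dualEquiv S v Y = 2 * Real.pi * inner ℝ v (S Y) := by
  change inner ℝ ((2 * Real.pi) • v) (S Y) = _
  rw [real_inner_smul_left]

variable [MeasurableSpace E] [BorelSpace E]

/-- The Fourier transform of a function on the dual space. -/
def dualFourier (dp : Measure (StrongDual ℝ E)) (u : StrongDual ℝ E → ℂ) (Y : E) : ℂ :=
  ∫ p, u p * Complex.exp (-Complex.I * (p Y : ℂ)) ∂dp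

/-- Both spaces are identified with one Euclidean space V so that the pairing becomes 2π⟨v, w⟩.
There `dX` and `dp` are multiples a and c of Lebesgue measure, and the transform is the standard one
up to c. -/
lemma exists_schwartzMap_dualFourier (dX : Measure E) [dX.IsAddHaarMeasure]
    (dp : Measure (StrongDual ℝ E)) [dp.IsAddHaarMeasure] (hdp : IsFourierDual dX dp)
    (u : SchwartzMap (StrongDual ℝ E) ℂ) :
    ∃ K : SchwartzMap E ℂ, (∀ Y, K Y = dualFourier dp u Y) ∧
      ∫ Y, K Y ∂dX = ((2 * Real.pi) ^ Module.finrank ℝ E : ℝ) * u 0 := by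
  set V := EuclideanSpace ℝ (Fin (Module.finrank ℝ E))
  let S : E ≃L[ℝ] V := ContinuousLinearEquiv.ofFinrankEq (by simp [V])
  set T := dualEquiv S with hT
  obtain ⟨a, ha⟩ : ∃ a : NNReal, Measure.map S dX = a • (volume : Measure V) :=
    have := S.isAddHaarMeasure_map dX
    ⟨_, Measure.isAddLeftInvariant_eq_smul _ _⟩
  obtain ⟨c, hc⟩ : ∃ c : NNReal, Measure.map T.symm dp = c • (volume : Measure V) :=
    have := T.symm.isAddHaarMeasure_map dp
    ⟨_, Measure.isAddLeftInvariant_eq_smul _ _⟩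
  have hdX (f : V → ℂ) : ∫ Y, f (S Y) ∂dX = a * ∫ v, f v := by
    have h := S.toHomeomorph.toMeasurableEquiv.measurableEmbedding.integral_map (μ := dX) f
    change ∫ v, f v ∂(Measure.map S dX) = ∫ Y, f (S Y) ∂dX at h
    rw [← h, ha, integral_smul_nnreal_measure]
    rfl
  have hdp' (f : StrongDual ℝ E → ℂ) : ∫ p, f p ∂dp = c * ∫ v, f (T v) := by
    have h := T.symm.toHomeomorph.toMeasurableEquiv.measurableEmbedding.integral_map (μ := dp)
      (fun v => f (T v))
    change ∫ v, f (T v) ∂(Measure.map T.symm dp) = ∫ p, f (T (T.symm p)) ∂dp at h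
    simp only [ContinuousLinearEquiv.apply_symm_apply] at h
    rw [← h, hc, integral_smul_nnreal_measure]
    rfl
  have hexp (v : V) (Y : E) : Complex.exp (-Complex.I * (T v Y : ℂ)) =
      Complex.exp (((-2 * Real.pi * inner ℝ v (S Y) : ℝ) : ℂ) * Complex.I) := by
    rw [hT, dualEquiv_apply]
    congr 1
    push_cast
    ring
  -- The normalization of `dp` enters only here: inversion at 0 for one function with f(0) = 1 fixes
  -- the product c a.
  have hac : (c * a : ℂ) = ((2 * Real.pi) ^ Module.finrank ℝ E : ℝ) := by
    obtain ⟨b⟩ : Nonempty (ContDiffBump (0 : E)) := inferInstance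
    have hb : HasCompactSupport fun x : E => (b x : ℂ) :=
      b.hasCompactSupport.comp_left Complex.ofReal_zero
    have hb' : ContDiff ℝ ∞ fun x : E => (b x : ℂ) := Complex.ofRealCLM.contDiff.comp b.contDiff
    set f : SchwartzMap E ℂ := hb.toSchwartzMap hb'
    have hf0 : f 0 = 1 := by
      change (b 0 : ℂ) = 1
      rw [b.one_of_mem_closedBall (by simp [b.rIn_pos.le])]
      simp
    have h1 := hdp f 0
    set f' : SchwartzMap V ℂ := SchwartzMap.compCLMOfContinuousLinearEquiv ℂ S.symm f
    have h2 (v : V) : ∫ Y, f Y * Complex.exp (-Complex.I * (T v Y : ℂ)) ∂dX = a * 𝓕 f' v := by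
      rw [SchwartzMap.fourier_coe, Real.fourier_eq', ← hdX]
      congr 1
      ext Y
      rw [hexp, real_inner_comm, mul_comm]
      simp [f']
    simp only [map_zero, Complex.ofReal_zero, mul_zero, Complex.exp_zero, mul_one] at h1
    rw [hdp'] at h1
    simp only [h2] at h1
    rw [integral_const_mul, integral_fourier_schwartz] at h1
    have h3 : f' 0 = 1 := by simpa [f'] using hf0
    rw [h3, hf0] at h1
    have hpi : ((2 * Real.pi) ^ Module.finrank ℝ E : ℝ) ≠ 0 := by positivity
    have hpi' : (((2 * Real.pi) ^ Module.finrank ℝ E : ℝ) : ℂ) ≠ 0 := by exact_mod_cast hpi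
    rw [Complex.ofReal_div, Complex.ofReal_one] at h1
    field_simp at h1
    exact h1.symm
  set u' : SchwartzMap V ℂ := SchwartzMap.compCLMOfContinuousLinearEquiv ℂ T u
  refine ⟨(c : ℂ) • SchwartzMap.compCLMOfContinuousLinearEquiv ℂ S (𝓕 u'), fun Y => ?_, ?_⟩
  · rw [dualFourier, hdp']
    simp only [hexp]
    change (c : ℂ) * (𝓕 u') (S Y) = _
    rw [SchwartzMap.fourier_coe, Real.fourier_eq']
    congr 2
    ext v
    exact mul_comm _ _
  · change ∫ Y, (c : ℂ) * (𝓕 u') (S Y) ∂dX = _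
    rw [integral_const_mul, hdX, integral_fourier_schwartz, ← mul_assoc, hac]
    simp [u']

omit [MeasurableSpace E] [BorelSpace E] in
-- Integration by parts in p. It expresses first moments of the transform of u through derivatives
-- of u at 0.
lemma mul_dualFourier (dp : Measure (StrongDual ℝ E)) [dp.IsAddHaarMeasure]
    {u : StrongDual ℝ E → ℂ} (hu : ContDiff ℝ ∞ u) (hc : HasCompactSupport u)
    (ℓ : StrongDual ℝ E) (Y : E) :
    (ℓ Y : ℂ) * dualFourier dp u Y =
      -Complex.I * dualFourier dp (fun p => fderiv ℝ u p ℓ) Y := by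
  set e : StrongDual ℝ E → ℂ := fun p => Complex.exp (-Complex.I * (p Y : ℂ)) with he
  have hd (p) : HasFDerivAt e ((e p * -Complex.I) •
      (Complex.ofRealCLM.comp (ContinuousLinearMap.apply ℝ ℝ Y))) p := by
    have h1 : HasFDerivAt (fun p : StrongDual ℝ E => (p Y : ℂ))
        (Complex.ofRealCLM.comp (ContinuousLinearMap.apply ℝ ℝ Y)) p :=
      (Complex.ofRealCLM.comp (ContinuousLinearMap.apply ℝ ℝ Y)).hasFDerivAt
    have h2 := (h1.const_mul (-Complex.I)).cexp
    rwa [smul_smul] at h2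
  have hecont : Continuous e := continuous_iff_continuousAt.2 fun p => (hd p).continuousAt
  have hfd (p) : fderiv ℝ e p ℓ = e p * -Complex.I * ℓ Y := by
    rw [(hd p).fderiv]
    simp
  have hdu : Continuous fun p => fderiv ℝ u p ℓ := (hu.continuous_fderiv (by simp)).clm_apply
    continuous_const
  have hduc : HasCompactSupport fun p => fderiv ℝ u p ℓ := (hc.fderiv_apply ℝ ℓ)
  have key := integral_mul_fderiv_eq_neg_fderiv_mul_of_integrable (μ := dp) (f := u) (g := e)
    (v := ℓ) ((hdu.mul hecont).integrable_of_hasCompactSupport hduc.mul_right)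
    (by
      simp only [hfd]
      exact (hu.continuous.mul (by fun_prop)).integrable_of_hasCompactSupport hc.mul_right)
    ((hu.continuous.mul hecont).integrable_of_hasCompactSupport hc.mul_right)
    (fun p _ => (hu.differentiable (by simp)) p) (fun p _ => (hd p).differentiableAt)
  simp only [hfd] at key
  have h3 : ∫ p, u p * (e p * -Complex.I * (ℓ Y : ℂ)) ∂dp =
      (-Complex.I * ℓ Y) * dualFourier dp u Y := by
    rw [dualFourier, ← integral_const_mul]
    congr 1
    ext p
    ring
  rw [h3] at key
  have h4 : dualFourier dp (fun p => fderiv ℝ u p ℓ) Y = Complex.I * ℓ Y * dualFourier dp u Y := by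
    rw [dualFourier]
    linear_combination key
  rw [h4]
  linear_combination ((ℓ Y : ℂ) * dualFourier dp u Y) * Complex.I_mul_I

/-- The integral of a function against the Fourier transform of a dilated cut-off. -/
lemma integral_mul_dualFourier_dilate (dX : Measure E) [dX.IsAddHaarMeasure]
    (dp : Measure (StrongDual ℝ E)) [dp.IsAddHaarMeasure] (u : StrongDual ℝ E → ℂ) (g : E → ℂ)
    {ħ ε : ℝ} (hħ : ħ ≠ 0) (hε : 0 < ε) :
    ∫ X, g X * ∫ p, u (ε • p) * Complex.exp (-(Complex.I / (ħ : ℂ)) * (p X : ℂ)) ∂dp ∂dX =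
      (|ħ| ^ Module.finrank ℝ E : ℝ) * ∫ Y, g ((ε * ħ) • Y) * dualFourier dp u Y ∂dX := by
  set n := Module.finrank ℝ E with hn
  have hn' : Module.finrank ℝ (StrongDual ℝ E) = n := by
    rw [hn, ← Subspace.dual_finrank_eq (K := ℝ) (V := E)]
    exact (LinearMap.toContinuousLinearMap : (E →ₗ[ℝ] ℝ) ≃ₗ[ℝ] (E →L[ℝ] ℝ)).finrank_eq.symm
  have h1 (X : E) : ∫ p, u (ε • p) * Complex.exp (-(Complex.I / (ħ : ℂ)) * (p X : ℂ)) ∂dp =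
      ((ε ^ n)⁻¹ : ℝ) * dualFourier dp u ((ε * ħ)⁻¹ • X) := by
    have h2 := Measure.integral_comp_smul dp
      (fun p => u p * Complex.exp (-Complex.I * (p ((ε * ħ)⁻¹ • X) : ℂ))) ε
    rw [hn', abs_of_pos (by positivity)] at h2
    rw [dualFourier, ← Complex.real_smul, ← h2]
    congr 1
    ext p
    congr 2
    have hε' : (ε : ℂ) ≠ 0 := by exact_mod_cast hε.ne'
    have hħ' : (ħ : ℂ) ≠ 0 := by exact_mod_cast hħ
    simp only [map_smul, smul_apply, smul_eq_mul]
    push_cast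
    field_simp
  simp only [h1]
  have hεħ : ε * ħ ≠ 0 := mul_ne_zero hε.ne' hħ
  have h3 := Measure.integral_comp_smul dX
    (fun X => g X * dualFourier dp u ((ε * ħ)⁻¹ • X)) (ε * ħ)
  simp only [inv_smul_smul₀ hεħ] at h3
  rw [h3, ← hn, Complex.real_smul, ← mul_assoc, ← integral_const_mul]
  congr 1
  ext X
  -- The dilation in p contributes ε⁻ⁿ and the substitution X = εħY contributes |εħ|ⁿ, so all powers
  -- of ε cancel.
  have h4 : (|ħ| ^ n : ℝ) * |((ε * ħ) ^ n)⁻¹| = (ε ^ n)⁻¹ := by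
    rw [abs_inv, abs_pow, abs_mul, abs_of_pos hε, mul_pow]
    have : |ħ| ^ n ≠ 0 := pow_ne_zero _ (abs_ne_zero.2 hħ)
    field_simp
  rw [← Complex.ofReal_mul, h4]
  ring

/-- After rescaling, ε occurs only in g(εħY), while the transform is a fixed integrable function of
total mass (2π)ⁿ u(0); dominated convergence applies because g is bounded. -/
lemma tendsto_integral_mul_dualFourier (dX : Measure E) [dX.IsAddHaarMeasure]
    (dp : Measure (StrongDual ℝ E)) [dp.IsAddHaarMeasure] (hdp : IsFourierDual dX dp)
    {u : StrongDual ℝ E → ℂ} (hu : ContDiff ℝ ∞ u) (huc : HasCompactSupport u) {g : E → ℂ}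
    (hgm : Measurable g) {M : ℝ} (hM : ∀ X, ‖g X‖ ≤ M) (hg0 : ContinuousAt g 0)
    {ħ : ℝ} (hħ : ħ ≠ 0) :
    Filter.Tendsto (fun ε : ℝ => ∫ X, g X *
      ∫ p, u (ε • p) * Complex.exp (-(Complex.I / (ħ : ℂ)) * (p X : ℂ)) ∂dp ∂dX)
      (𝓝[>] 0) (𝓝 ((|2 * Real.pi * ħ| ^ Module.finrank ℝ E : ℝ) * (u 0 * g 0))) := by
  obtain ⟨K, hK, hKi⟩ := exists_schwartzMap_dualFourier dX dp hdp (huc.toSchwartzMap hu)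
  have hK' (Y) : dualFourier dp u Y = K Y := (hK Y).symm
  have hKi' : ∫ Y, K Y ∂dX = ((2 * Real.pi) ^ Module.finrank ℝ E : ℝ) * u 0 := hKi
  have h1 : Filter.Tendsto (fun ε : ℝ => ∫ Y, g ((ε * ħ) • Y) * K Y ∂dX) (𝓝[>] 0)
      (𝓝 (∫ Y, g 0 * K Y ∂dX)) := by
    refine tendsto_integral_filter_of_dominated_convergence (fun Y => M * ‖K Y‖) ?_ ?_
      (K.integrable.norm.const_mul M) ?_
    · exact Filter.Eventually.of_forall fun ε =>
        ((hgm.comp (measurable_const_smul (ε * ħ))).aestronglyMeasurable).mul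
          K.continuous.aestronglyMeasurable
    · refine Filter.Eventually.of_forall fun ε => Filter.Eventually.of_forall fun Y => ?_
      rw [norm_mul]
      gcongr
      exact hM _
    · refine Filter.Eventually.of_forall fun Y => ?_
      have h2 : Filter.Tendsto (fun ε : ℝ => (ε * ħ) • Y) (𝓝[>] 0) (𝓝 0) := by
        have h3 : Continuous fun ε : ℝ => (ε * ħ) • Y := by fun_prop
        have h4 := h3.tendsto 0
        simp only [zero_mul, zero_smul] at h4
        exact h4.mono_left nhdsWithin_le_nhds
      exact (hg0.tendsto.comp h2).mul_const _
  have h5 := h1.const_mul ((|ħ| ^ Module.finrank ℝ E : ℝ) : ℂ)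
  refine (h5.congr' ?_).trans (le_of_eq ?_)
  · filter_upwards [self_mem_nhdsWithin] with ε hε
    rw [integral_mul_dualFourier_dilate dX dp u g hħ hε]
    simp only [hK']
  · rw [integral_const_mul, hKi', abs_mul, abs_of_pos (by positivity : (0 : ℝ) < 2 * Real.pi),
      mul_pow]
    push_cast
    ring_nf

omit [FiniteDimensional ℝ E] [MeasurableSpace E] [BorelSpace E] in
lemma exists_norm_sub_le_of_hasFDerivAt {F : Type*} [NormedAddCommGroup F] [NormedSpace ℝ F]
    {g : E → F} {M : ℝ} (hM : ∀ X, ‖g X‖ ≤ M) {L : E →L[ℝ] F} (hg : HasFDerivAt g L 0) :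
    ∃ C, ∀ X, ‖g X - g 0‖ ≤ C * ‖X‖ := by
  obtain ⟨C, hC⟩ := hg.isBigO_sub.bound
  obtain ⟨δ, hδ, h⟩ := Metric.eventually_nhds_iff_ball.1 hC
  have hM0 : 0 ≤ M := (norm_nonneg _).trans (hM 0)
  refine ⟨max C (2 * M / δ), fun X => ?_⟩
  by_cases hX : ‖X‖ < δ
  · have h1 := h X (mem_ball_zero_iff.2 hX)
    rw [sub_zero] at h1
    exact h1.trans (by gcongr; exact le_max_left _ _)
  · push Not at hX
    calc ‖g X - g 0‖ ≤ M + M := (norm_sub_le _ _).trans (add_le_add (hM _) (hM _))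
      _ = 2 * M / δ * δ := by field_simp; ring
      _ ≤ 2 * M / δ * ‖X‖ := by gcongr
      _ ≤ _ := by gcongr; exact le_max_right _ _

/-- Because u(0) = 0, the transform K of u has integral zero and g(εħY) may be replaced by g(εħY) -
g(0). Divided by ε this is at most C|ħ|‖Y‖ and tends to L(ħY), so the limit is a first moment of K,
given by du(0). -/
lemma tendsto_inv_mul_integral_mul_dualFourier (dX : Measure E) [dX.IsAddHaarMeasure]
    (dp : Measure (StrongDual ℝ E)) [dp.IsAddHaarMeasure] (hdp : IsFourierDual dX dp)
    {u : StrongDual ℝ E → ℂ} (hu : ContDiff ℝ ∞ u) (huc : HasCompactSupport u) (hu0 : u 0 = 0)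
    {X₀ : E} (hdu : ∀ ℓ, fderiv ℝ u 0 ℓ = (ℓ X₀ : ℂ)) {g : E → ℂ}
    (hgm : Measurable g) {M : ℝ} (hM : ∀ X, ‖g X‖ ≤ M) {L : E →L[ℝ] ℂ} (hg : HasFDerivAt g L 0)
    {ħ : ℝ} (hħ : ħ ≠ 0) :
    Filter.Tendsto (fun ε : ℝ => (ε : ℂ)⁻¹ * ∫ X, g X *
      ∫ p, u (ε • p) * Complex.exp (-(Complex.I / (ħ : ℂ)) * (p X : ℂ)) ∂dp ∂dX)
      (𝓝[>] 0) (𝓝 ((|2 * Real.pi * ħ| ^ Module.finrank ℝ E : ℝ) *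
        (-Complex.I * ħ * L X₀))) := by
  obtain ⟨K, hK, hKi⟩ := exists_schwartzMap_dualFourier dX dp hdp (huc.toSchwartzMap hu)
  have hK' (Y) : dualFourier dp u Y = K Y := (hK Y).symm
  have hKi' : ∫ Y, K Y ∂dX = 0 := by
    have h : ∫ Y, K Y ∂dX = ((2 * Real.pi) ^ Module.finrank ℝ E : ℝ) * u 0 := hKi
    rw [h, hu0, mul_zero]
  obtain ⟨C, hC⟩ := exists_norm_sub_le_of_hasFDerivAt hM hg
  have hKi1 : Integrable (fun Y => ‖Y‖ * ‖K Y‖) dX := by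
    simpa using K.integrable_pow_mul dX 1
  have hm (ε : ℝ) : AEStronglyMeasurable (fun Y => g ((ε * ħ) • Y)) dX :=
    (hgm.comp (measurable_const_smul (ε * ħ))).aestronglyMeasurable
  have h1 : Filter.Tendsto
      (fun ε : ℝ => ∫ Y, (ε : ℂ)⁻¹ * (g ((ε * ħ) • Y) - g 0) * K Y ∂dX) (𝓝[>] 0)
      (𝓝 (∫ Y, L (ħ • Y) * K Y ∂dX)) := by
    refine tendsto_integral_filter_of_dominated_convergence
      (fun Y => C * |ħ| * (‖Y‖ * ‖K Y‖)) ?_ ?_ (hKi1.const_mul _) ?_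
    · exact Filter.Eventually.of_forall fun ε =>
        (((hm ε).sub aestronglyMeasurable_const).const_mul _).mul
          K.continuous.aestronglyMeasurable
    · filter_upwards [self_mem_nhdsWithin] with ε (hε : 0 < ε)
      refine Filter.Eventually.of_forall fun Y => ?_
      rw [norm_mul, norm_mul, norm_inv, Complex.norm_real, Real.norm_of_nonneg hε.le, ← mul_assoc]
      refine mul_le_mul_of_nonneg_right ?_ (norm_nonneg _)
      rw [inv_mul_le_iff₀ hε]
      refine (hC _).trans_eq ?_
      rw [norm_smul, norm_mul, Real.norm_of_nonneg hε.le, Real.norm_eq_abs]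
      ring
    · refine Filter.Eventually.of_forall fun Y => ?_
      have h2 : HasDerivAt (fun ε : ℝ => g (ε • (ħ • Y))) (L (ħ • Y)) 0 := by
        have h3 : HasDerivAt (fun ε : ℝ => ε • (ħ • Y)) (ħ • Y) 0 := by
          simpa using (hasDerivAt_id (0 : ℝ)).smul_const (ħ • Y)
        have h4 : HasFDerivAt g L ((0 : ℝ) • (ħ • Y)) := by rwa [zero_smul]
        exact h4.comp_hasDerivAt (0 : ℝ) h3
      have h5 := (hasDerivAt_iff_tendsto_slope_zero.1 h2).mono_left
        (nhdsWithin_mono 0 (fun x (hx : 0 < x) => hx.ne'))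
      refine (h5.congr fun ε => ?_).mul_const _
      rw [zero_add, zero_smul, smul_smul, Complex.real_smul, Complex.ofReal_inv]
  have h6 (ε : ℝ) : ∫ Y, (ε : ℂ)⁻¹ * (g ((ε * ħ) • Y) - g 0) * K Y ∂dX =
      (ε : ℂ)⁻¹ * ∫ Y, g ((ε * ħ) • Y) * K Y ∂dX := by
    simp only [mul_assoc, sub_mul]
    rw [integral_const_mul, integral_sub, integral_const_mul, hKi', mul_zero, sub_zero]
    · exact K.integrable.bdd_mul (hm ε) (Filter.Eventually.of_forall fun Y => hM _)
    · exact K.integrable.const_mul _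
  -- By `mul_dualFourier`, a linear function times K is -i times the transform of ∂_ℓ u, whose
  -- integral is (2π)ⁿ ∂_ℓ u(0).
  have hmom (ℓ : StrongDual ℝ E) : Integrable (fun Y => (ℓ Y : ℂ) * K Y) dX ∧
      ∫ Y, (ℓ Y : ℂ) * K Y ∂dX =
        -Complex.I * (((2 * Real.pi) ^ Module.finrank ℝ E : ℝ) * (ℓ X₀ : ℂ)) := by
    have hv : ContDiff ℝ ∞ fun p => fderiv ℝ u p ℓ :=
      (hu.fderiv_right (m := ∞) le_rfl).clm_apply contDiff_const
    have hvc : HasCompactSupport fun p => fderiv ℝ u p ℓ := huc.fderiv_apply ℝ ℓ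
    obtain ⟨K₁, hK₁, hK₁i⟩ := exists_schwartzMap_dualFourier dX dp hdp (hvc.toSchwartzMap hv)
    have hK₁' (Y) : dualFourier dp (fun p => fderiv ℝ u p ℓ) Y = K₁ Y := (hK₁ Y).symm
    have hK₁i' : ∫ Y, K₁ Y ∂dX =
        ((2 * Real.pi) ^ Module.finrank ℝ E : ℝ) * fderiv ℝ u 0 ℓ := hK₁i
    have h7 (Y) : (ℓ Y : ℂ) * K Y = -Complex.I * K₁ Y := by
      rw [← hK', ← hK₁', mul_dualFourier dp hu huc]
    simp only [h7]
    refine ⟨K₁.integrable.const_mul _, ?_⟩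
    rw [integral_const_mul, hK₁i', hdu]
  set b := Module.finBasis ℝ E
  have hL (Y : E) : L Y = ∑ i, (LinearMap.toContinuousLinearMap (b.coord i) Y : ℂ) * L (b i) := by
    calc L Y = L (∑ i, b.repr Y i • b i) := by rw [b.sum_repr]
      _ = _ := by
        simp only [map_sum, map_smul, Complex.real_smul]
        rfl
  have h8 : ∫ Y, L (ħ • Y) * K Y ∂dX =
      ħ * (-Complex.I * (((2 * Real.pi) ^ Module.finrank ℝ E : ℝ) * L X₀)) := by
    have h9 (Y : E) : L (ħ • Y) * K Y = ħ * ∑ i, L (b i) *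
        ((LinearMap.toContinuousLinearMap (b.coord i) Y : ℂ) * K Y) := by
      rw [map_smul, Complex.real_smul, hL Y, mul_assoc, Finset.sum_mul]
      congr 1
      exact Finset.sum_congr rfl fun i _ => by ring
    simp only [h9]
    rw [integral_const_mul, integral_finsetSum _ fun i _ => (hmom _).1.const_mul _]
    simp only [integral_const_mul, (hmom _).2]
    rw [hL X₀]
    simp only [Finset.mul_sum]
    exact Finset.sum_congr rfl fun i _ => by ring
  have h10 := h1.const_mul ((|ħ| ^ Module.finrank ℝ E : ℝ) : ℂ)
  refine (h10.congr' ?_).trans (le_of_eq ?_)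
  · filter_upwards [self_mem_nhdsWithin] with ε hε
    rw [integral_mul_dualFourier_dilate dX dp u g hħ hε, h6]
    simp only [hK']
    ring
  · rw [h8, abs_mul, abs_of_pos (by positivity : (0 : ℝ) < 2 * Real.pi), mul_pow]
    push_cast
    ring_nf

end Fourier

/-! ### Exchange of the integrations over q, p and X -/

section Fubini

lemma norm_integral_left_le {S G : Type*} [TopologicalSpace G] [MeasurableSpace G]
    (m : Measure G) [IsFiniteMeasureOnCompacts m] {J : G × S → ℂ} {K : Set G} (hK : IsCompact K)
    (hJ0 : ∀ q X, q ∉ K → J (q, X) = 0) {M : ℝ} (hM : ∀ z, ‖J z‖ ≤ M) (X : S) :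
    ‖∫ q, J (q, X) ∂m‖ ≤ M * m.real K := by
  rw [← setIntegral_eq_integral_of_forall_compl_eq_zero fun q hq => hJ0 q X hq]
  exact norm_setIntegral_le_of_norm_le_const hK.measure_lt_top fun q _ => hM _

variable {E : Type*} [NormedAddCommGroup E] [NormedSpace ℝ E] [FiniteDimensional ℝ E]
variable [MeasurableSpace E] [BorelSpace E]
variable {G : Type*} [TopologicalSpace G] [MeasurableSpace G]

lemma integral_mul_fourier_prod (m : Measure G) [SFinite m] [IsFiniteMeasureOnCompacts m]
    (dX : Measure E) [SFinite dX] [IsFiniteMeasureOnCompacts dX] (dp : Measure (StrongDual ℝ E))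
    [SFinite dp] [IsFiniteMeasureOnCompacts dp] {J : G × E → ℂ} (hJ : Measurable J)
    {K : Set G} (hK : IsCompact K) {B : Set E} (hB : IsCompact B)
    (hJK : ∀ q X, q ∉ K → J (q, X) = 0) (hJB : ∀ q X, X ∉ B → J (q, X) = 0) {M : ℝ}
    (hM : ∀ z, ‖J z‖ ≤ M) {u : StrongDual ℝ E → ℂ} (hu : Continuous u)
    (huc : HasCompactSupport u) (ħ : ℝ) :
    Integrable (fun x : G × StrongDual ℝ E => u x.2 *
      ∫ X, J (x.1, X) * Complex.exp (-(Complex.I / (ħ : ℂ)) * (x.2 X : ℂ)) ∂dX) (m.prod dp) ∧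
    ∫ x : G × StrongDual ℝ E, u x.2 *
      ∫ X, J (x.1, X) * Complex.exp (-(Complex.I / (ħ : ℂ)) * (x.2 X : ℂ)) ∂dX ∂(m.prod dp) =
    ∫ X, (∫ q, J (q, X) ∂m) *
      ∫ p, u p * Complex.exp (-(Complex.I / (ħ : ℂ)) * (p X : ℂ)) ∂dp ∂dX := by
  have := FiniteDimensional.proper ℝ E
  have := FiniteDimensional.proper ℝ (StrongDual ℝ E)
  obtain ⟨C, hC⟩ := huc.exists_bound_of_continuous hu
  set H : (G × StrongDual ℝ E) × E → ℂ := fun z => u z.1.2 * (J (z.1.1, z.2) *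
    Complex.exp (-(Complex.I / (ħ : ℂ)) * (z.1.2 z.2 : ℂ))) with hH
  have hexp : ∀ t : ℝ, ‖Complex.exp (-(Complex.I / (ħ : ℂ)) * (t : ℂ))‖ = 1 := fun t => by
    have : -(Complex.I / (ħ : ℂ)) * (t : ℂ) = ((-(t / ħ) : ℝ) : ℂ) * Complex.I := by
      push_cast; ring
    rw [this, Complex.norm_exp_ofReal_mul_I]
  have hHm : Measurable H := by
    refine (hu.measurable.comp (measurable_snd.comp measurable_fst)).mul (Measurable.mul ?_ ?_)
    · exact hJ.comp ((measurable_fst.comp measurable_fst).prodMk measurable_snd)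
    · refine Complex.measurable_exp.comp (measurable_const.mul (Complex.measurable_ofReal.comp ?_))
      have h : Measurable fun z : StrongDual ℝ E × E => z.1 z.2 :=
        (by fun_prop : Continuous fun z : StrongDual ℝ E × E => z.1 z.2).measurable
      exact h.comp ((measurable_snd.comp measurable_fst).prodMk measurable_snd)
  have hHi : Integrable H ((m.prod dp).prod dX) := by
    have hsub : Function.support H ⊆ (K ×ˢ tsupport u) ×ˢ B := by
      rintro ⟨⟨q, p⟩, X⟩ hz
      refine ⟨⟨?_, ?_⟩, ?_⟩ <;> by_contra hn <;> refine hz ?_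
      · simp [hH, hJK q X hn]
      · simp [hH, image_eq_zero_of_notMem_tsupport hn]
      · simp [hH, hJB q X hn]
    rw [← integrableOn_iff_integrable_of_support_subset hsub]
    refine Measure.integrableOn_of_bounded (M := C * M) ?_ hHm.aestronglyMeasurable
      (Filter.Eventually.of_forall fun z => ?_)
    · rw [Measure.prod_prod, Measure.prod_prod]
      exact (ENNReal.mul_lt_top (ENNReal.mul_lt_top hK.measure_lt_top huc.measure_lt_top)
        hB.measure_lt_top).ne
    · rw [hH, norm_mul, norm_mul, hexp, mul_one]
      exact mul_le_mul (hC _) (hM _) (norm_nonneg _) ((norm_nonneg _).trans (hC 0))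
  have e1 : ∀ x : G × StrongDual ℝ E, u x.2 *
      ∫ X, J (x.1, X) * Complex.exp (-(Complex.I / (ħ : ℂ)) * (x.2 X : ℂ)) ∂dX =
      ∫ X, H (x, X) ∂dX := fun x => (integral_const_mul _ _).symm
  simp only [e1]
  refine ⟨hHi.integral_prod_left, ?_⟩
  rw [integral_integral_swap hHi]
  refine integral_congr_ae (Filter.Eventually.of_forall fun X => ?_)
  refine Eq.trans ?_ (integral_prod_mul (μ := m) (ν := dp) (fun q => J (q, X)) fun p =>
    u p * Complex.exp (-(Complex.I / (ħ : ℂ)) * (p X : ℂ)))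
  refine integral_congr_ae (Filter.Eventually.of_forall fun x => ?_)
  simp only [hH]
  ring

end Fubini

/-! ### The integrand of the Wigner function and its derivative at X = 0 -/

section Kernel

variable {E : Type*} [NormedAddCommGroup E] [NormedSpace ℝ E]
variable {G : Type*} [TopologicalSpace G] [ChartedSpace E G] [Group G]

/-- The product of the functions entering the Wigner function, without the Jacobian factor. -/
def wignerKernel (f φ ψ : G → ℂ) (X : E) (q : G) : ℂ :=
  f q * ((starRingEnd ℂ) (φ (q * lieExp G ((1 / 2 : ℝ) • X))) *
    ψ (q * lieExp G (-(1 / 2 : ℝ) • X)))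

variable [FiniteDimensional ℝ E] [LieGroup 𝓘(ℝ, E) ∞ G]

/-- The integrand of the Wigner function, without the exponential factor. -/
def wignerIntegrand (𝒪 : Set E) (f φ ψ : G → ℂ) (z : G × E) : ℂ :=
  (Set.univ ×ˢ 𝒪).indicator (fun z : G × E => wignerKernel f φ ψ z.2 z.1 * (jacF G z.2 : ℂ)) z

lemma mul_wigner_eq [MeasurableSpace E] [BorelSpace E] (ħ : ℝ) (dX : Measure E) {𝒪 : Set E}
    (h𝒪 : IsOpen 𝒪) (f φ ψ : G → ℂ) (x : G × StrongDual ℝ E) :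
    f x.1 * wigner ħ dX 𝒪 φ ψ x = ∫ X, wignerIntegrand 𝒪 f φ ψ (x.1, X) *
      Complex.exp (-(Complex.I / (ħ : ℂ)) * (x.2 X : ℂ)) ∂dX := by
  rw [wigner, ← integral_indicator h𝒪.measurableSet, ← integral_const_mul]
  refine integral_congr_ae (Filter.Eventually.of_forall fun X => ?_)
  by_cases hX : X ∈ 𝒪
  · simp only [wignerIntegrand, wignerKernel, Set.indicator_of_mem hX,
      Set.indicator_of_mem (show (x.1, X) ∈ (Set.univ : Set G) ×ˢ 𝒪 from ⟨trivial, hX⟩)]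
    ring
  · simp only [wignerIntegrand, Set.indicator_of_notMem hX,
      Set.indicator_of_notMem (show (x.1, X) ∉ (Set.univ : Set G) ×ˢ 𝒪 from fun h => hX h.2)]
    ring

omit [FiniteDimensional ℝ E] in
lemma contMDiffAt_wignerKernel [MeasurableSpace G] {m : Measure G} {𝒪 : Set E}
    (h𝒪 : IsWeaklyExponential m 𝒪)
    {f φ ψ : G → ℂ} (hf : ContMDiff 𝓘(ℝ, E) 𝓘(ℝ, ℂ) ∞ f) (hφ : ContMDiff 𝓘(ℝ, E) 𝓘(ℝ, ℂ) ∞ φ)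
    (hψ : ContMDiff 𝓘(ℝ, E) 𝓘(ℝ, ℂ) ∞ ψ) {X : E} (hX : X ∈ 𝒪) (q : G) :
    ContMDiffAt (𝓘(ℝ, E).prod 𝓘(ℝ, E)) 𝓘(ℝ, ℂ) ∞
      (Function.uncurry (wignerKernel f φ ψ)) (X, q) := by
  have h1 : ∀ c : ℝ, c • X ∈ 𝒪 → ContMDiffAt (𝓘(ℝ, E).prod 𝓘(ℝ, E)) 𝓘(ℝ, E) ∞
      (fun z : E × G => z.2 * lieExp G (c • z.1)) (X, q) := fun c hc => by
    refine contMDiffAt_snd.mul ?_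
    have h2 : ContMDiffAt 𝓘(ℝ, E) 𝓘(ℝ, E) ∞ (lieExp G) (c • X) :=
      h𝒪.contMDiffOn_exp.contMDiffAt (h𝒪.isOpen.mem_nhds hc)
    have h3 : ContMDiffAt (𝓘(ℝ, E).prod 𝓘(ℝ, E)) 𝓘(ℝ, E) ∞ (fun z : E × G => c • z.1) (X, q) :=
      ContMDiffAt.comp (g := fun Y : E => c • Y) (f := Prod.fst) (X, q)
        (contDiff_const_smul c).contMDiff.contMDiffAt contMDiffAt_fst
    exact ContMDiffAt.comp (g := lieExp G) (f := fun z : E × G => c • z.1) (X, q) h2 h3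
  have hconj : ContMDiff 𝓘(ℝ, ℂ) 𝓘(ℝ, ℂ) ∞ (starRingEnd ℂ) :=
    (Complex.conjCLE.contDiff).contMDiff
  have h4 := ContMDiffAt.comp (g := φ) (f := fun z : E × G => z.2 * lieExp G ((1 / 2 : ℝ) • z.1))
    (X, q) hφ.contMDiffAt (h1 _ (h𝒪.smul_mem X hX _ (by norm_num) (by norm_num)))
  have h5 := ContMDiffAt.comp (g := ψ) (f := fun z : E × G => z.2 * lieExp G (-(1 / 2 : ℝ) • z.1))
    (X, q) hψ.contMDiffAt (h1 _ (h𝒪.smul_mem X hX _ (by norm_num) (by norm_num)))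
  have h6 := ContMDiffAt.comp (g := f) (f := Prod.snd) (X, q) hf.contMDiffAt
    (contMDiffAt_snd (I := 𝓘(ℝ, E)) (J := 𝓘(ℝ, E)) (n := ∞))
  have h7 := ContMDiffAt.comp (g := (starRingEnd ℂ)) (X, q) hconj.contMDiffAt h4
  have hmul : ContMDiff 𝓘(ℝ, ℂ × ℂ) 𝓘(ℝ, ℂ) ∞ (fun z : ℂ × ℂ => z.1 * z.2) :=
    (contDiff_mul (𝕜 := ℝ) (𝔸 := ℂ)).contMDiff
  have h8 := ContMDiffAt.comp (g := fun z : ℂ × ℂ => z.1 * z.2) (X, q) hmul.contMDiffAt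
    (h7.prodMk_space h5)
  exact ContMDiffAt.comp (g := fun z : ℂ × ℂ => z.1 * z.2) (X, q) hmul.contMDiffAt
    (h6.prodMk_space h8)

/-- The factor 1/2 and the opposite signs come from exp(X/2) and exp(-X/2), as exp has the identity
as differential at 0. -/
lemma fderiv_wignerKernel [T2Space G] [MeasurableSpace G] {m : Measure G} {𝒪 : Set E}
    (h𝒪 : IsWeaklyExponential m 𝒪)
    {f φ ψ : G → ℂ} (hφ : ContMDiff 𝓘(ℝ, E) 𝓘(ℝ, ℂ) ∞ φ)
    (hψ : ContMDiff 𝓘(ℝ, E) 𝓘(ℝ, ℂ) ∞ ψ) (q : G) (Y : E) :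
    fderiv ℝ (fun X : E => wignerKernel f φ ψ X q) 0 Y = (1 / 2 : ℂ) * (f q *
      ((starRingEnd ℂ) (leftFDeriv φ q Y) * ψ q - (starRingEnd ℂ) (φ q) * leftFDeriv ψ q Y)) := by
  have h0 : ∀ c : ℝ, lieExp G (c • (0 : E)) = 1 := fun c => by rw [smul_zero, lieExp_zero]
  have h1 : ∀ c : ℝ, HasMFDerivAt 𝓘(ℝ, E) 𝓘(ℝ, E) (fun X : E => lieExp G (c • X)) 0
      (c • ContinuousLinearMap.id ℝ E) := fun c => by
    have h2 : HasMFDerivAt 𝓘(ℝ, E) 𝓘(ℝ, E) (fun X : E => c • X) 0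
        (c • ContinuousLinearMap.id ℝ E) :=
      ((hasFDerivAt_id (0 : E)).const_smul c).hasMFDerivAt
    have h3 := hasMFDerivAt_lieExp (G := G) h𝒪.isOpen h𝒪.zero_mem h𝒪.contMDiffOn_exp
    rw [← smul_zero c] at h3
    exact HasMFDerivAt.comp (g := lieExp G) (0 : E) h3 h2
  have hφ' := hasFDerivAt_comp_mul_left (γ := fun X : E => lieExp G ((1 / 2 : ℝ) • X)) hφ (h0 _) (h1 (1 / 2)) q
  have hψ' := hasFDerivAt_comp_mul_left (γ := fun X : E => lieExp G (-(1 / 2 : ℝ) • X)) hψ (h0 _) (h1 (-(1 / 2))) q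
  have hc := Complex.conjCLE.toContinuousLinearMap.hasFDerivAt.comp (0 : E) hφ'
  have h := (hc.mul hψ').const_mul (f q)
  have h' : HasFDerivAt (fun X : E => wignerKernel f φ ψ X q) _ 0 := h
  rw [h'.fderiv]
  simp [lieExp_zero]
  ring

end Kernel

/-! ### Compact support and first-order expansion of the integrand -/

section Integrand

variable {E : Type*} [NormedAddCommGroup E] [NormedSpace ℝ E] [FiniteDimensional ℝ E]
variable {G : Type*} [TopologicalSpace G] [ChartedSpace E G] [Group G] [LieGroup 𝓘(ℝ, E) ∞ G]
variable [T2Space G] [MeasurableSpace G] {m : Measure G} {𝒪 : Set E}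

open Pointwise in
/-- The supports of the integrands of a Wigner function are contained in a compact set. -/
lemma exists_isCompact_of_wignerKernel_ne_zero (h𝒪 : IsWeaklyExponential m 𝒪) {φ ψ : G → ℂ}
    (hφ : HasCompactSupport φ) (hψ : HasCompactSupport ψ) :
    ∃ K : Set G, IsCompact K ∧ ∃ B : Set E, IsCompact B ∧
      ∀ (f : G → ℂ), ∀ X ∈ 𝒪, ∀ q, wignerKernel f φ ψ X q ≠ 0 → q ∈ K ∧ X ∈ B := by
  have : IsTopologicalGroup G := topologicalGroup_of_lieGroup 𝓘(ℝ, E) ∞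
  set S : Set G := lieExp G '' 𝒪 ∩ ((tsupport ψ)⁻¹ * tsupport φ) with hS
  have hSc : IsCompact (closure S) :=
    (hψ.isCompact.inv.mul hφ.isCompact).closure_of_subset Set.inter_subset_right
  have hB := h𝒪.precompact S Set.inter_subset_left hSc
  -- The halves X/2 form a bounded set whose closure may leave `𝒪`; a compact set containing their
  -- exponentials is still available.
  obtain ⟨C, hC, hCB⟩ := exists_isCompact_lieExp_mem G h𝒪.isOpen h𝒪.zero_mem h𝒪.contMDiffOn_exp
    (hB.isBounded.smul₀ (1 / 2 : ℝ))
  refine ⟨tsupport φ * C⁻¹, hφ.isCompact.mul hC.inv, _, hB, fun f X hX q hq => ?_⟩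
  have h1 : q * lieExp G ((1 / 2 : ℝ) • X) ∈ tsupport φ := by
    by_contra h
    exact hq (by simp only [wignerKernel, image_eq_zero_of_notMem_tsupport h, map_zero, zero_mul,
      mul_zero])
  have h2 : q * lieExp G (-(1 / 2 : ℝ) • X) ∈ tsupport ψ := by
    by_contra h
    exact hq (by simp only [wignerKernel, image_eq_zero_of_notMem_tsupport h, mul_zero])
  -- The point q cancels, so exp X lies in (supp ψ)⁻¹ supp φ, and the precompactness hypothesis
  -- bounds X.
  have h3 : (q * lieExp G (-(1 / 2 : ℝ) • X))⁻¹ * (q * lieExp G ((1 / 2 : ℝ) • X)) =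
      lieExp G X := by
    have h := lieExp_add_smul (G := G) X (-(1 / 2)) 1
    rw [one_smul, show (-(1 / 2) + 1 : ℝ) = 1 / 2 by norm_num] at h
    rw [h]
    group
  have h4 : X ∈ closure (𝒪 ∩ lieExp G ⁻¹' S) := subset_closure
    ⟨hX, ⟨X, hX, rfl⟩, h3 ▸ Set.mul_mem_mul (Set.inv_mem_inv.2 h2) h1⟩
  refine ⟨?_, h4⟩
  rw [← mul_inv_cancel_right q (lieExp G ((1 / 2 : ℝ) • X))]
  exact Set.mul_mem_mul h1 (Set.inv_mem_inv.2 (hCB _ (Set.smul_mem_smul_set h4)))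

/-- The properties of the integrand which allow one to apply Fubini's theorem. -/
structure IsTameIntegrand (J : G × E → ℂ) [MeasurableSpace E] (K : Set G) (B : Set E) (M : ℝ) :
    Prop where
  measurable : Measurable J
  isCompact_left : IsCompact K
  isCompact_right : IsCompact B
  eq_zero_left : ∀ q X, q ∉ K → J (q, X) = 0
  eq_zero_right : ∀ q X, X ∉ B → J (q, X) = 0
  norm_le : ∀ z, ‖J z‖ ≤ M

lemma exists_isTameIntegrand [MeasurableSpace E] [BorelSpace E] [BorelSpace G]
    [SecondCountableTopology G] (h𝒪 : IsWeaklyExponential m 𝒪) {f : G → ℂ}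
    (hf : ContMDiff 𝓘(ℝ, E) 𝓘(ℝ, ℂ) ∞ f) (φ ψ : testFunctions E G) :
    ∃ K B M, IsTameIntegrand (wignerIntegrand 𝒪 f φ ψ) K B M ∧
      ∀ X ∈ 𝒪, ∀ q ∉ K, wignerKernel f φ ψ X q = 0 := by
  have := FiniteDimensional.proper ℝ E
  obtain ⟨K, hK, B, hB, hKB⟩ := exists_isCompact_of_wignerKernel_ne_zero h𝒪 φ.2.2 ψ.2.2
  obtain ⟨Cf, hCf⟩ := hK.exists_bound_of_continuousOn hf.continuous.continuousOn
  obtain ⟨Cφ, hCφ⟩ := φ.2.2.exists_bound_of_continuous φ.2.1.continuous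
  obtain ⟨Cψ, hCψ⟩ := ψ.2.2.exists_bound_of_continuous ψ.2.1.continuous
  obtain ⟨CF, hCF⟩ := hB.exists_bound_of_continuousOn (continuous_jacF (E := E) G).continuousOn
  have hz : ∀ q X, wignerIntegrand 𝒪 f φ ψ (q, X) ≠ 0 →
      (wignerIntegrand 𝒪 f φ ψ (q, X) = wignerKernel f φ ψ X q * (jacF G X : ℂ)) ∧
      q ∈ K ∧ X ∈ B := fun q X h => by
    have h1 : (q, X) ∈ (Set.univ : Set G) ×ˢ 𝒪 := Set.mem_of_indicator_ne_zero h
    have h2 := Set.indicator_of_mem h1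
      (fun z : G × E => wignerKernel f φ ψ z.2 z.1 * (jacF G z.2 : ℂ))
    refine ⟨h2, hKB f X h1.2 q fun h3 => h ?_⟩
    rw [wignerIntegrand, h2, h3, zero_mul]
  refine ⟨K, B, |Cf| * (|Cφ| * |Cψ|) * |CF|, ⟨?_, hK, hB, fun q X hq => ?_, fun q X hX => ?_, ?_⟩,
    fun X hX q hq => ?_⟩
  · have hms : MeasurableSet ((Set.univ : Set G) ×ˢ 𝒪) :=
      MeasurableSet.univ.prod h𝒪.isOpen.measurableSet
    have hc : ContinuousOn (fun z : G × E => wignerKernel f φ ψ z.2 z.1 * (jacF G z.2 : ℂ))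
        (Set.univ ×ˢ 𝒪) := fun z hz => by
      refine ContinuousAt.continuousWithinAt (ContinuousAt.mul ?_ ?_)
      · exact ContinuousAt.comp (g := Function.uncurry (wignerKernel f φ ψ)) (f := Prod.swap)
          (contMDiffAt_wignerKernel h𝒪 hf φ.2.1 ψ.2.1 hz.2 z.1).continuousAt
          continuous_swap.continuousAt
      · exact (Complex.continuous_ofReal.comp
          ((continuous_jacF (E := E) G).comp continuous_snd)).continuousAt
    classical
    have h := hc.measurable_piecewise (g := 0) continuousOn_const hms
    rw [Set.piecewise_eq_indicator] at h
    exact h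
  · by_contra h
    exact hq (hz q X h).2.1
  · by_contra h
    exact hX (hz q X h).2.2
  · rintro ⟨q, X⟩
    by_cases h : wignerIntegrand 𝒪 f φ ψ (q, X) = 0
    · rw [h, norm_zero]
      positivity
    · obtain ⟨h1, h2, h3⟩ := hz q X h
      rw [h1, wignerKernel, norm_mul, norm_mul, norm_mul, RCLike.norm_conj, Complex.norm_real]
      gcongr
      · exact (hCf q h2).trans (le_abs_self _)
      · exact (hCφ _).trans (le_abs_self _)
      · exact (hCψ _).trans (le_abs_self _)
      · exact (hCF X h3).trans (le_abs_self _)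
  · by_contra h
    exact hq (hKB f X hX q h).1

variable [MeasurableSpace E] [BorelSpace E] [BorelSpace G] [SecondCountableTopology G]
  [IsFiniteMeasureOnCompacts m]

omit [MeasurableSpace E] [BorelSpace E] in
/-- Partial integration in the Wigner function yields a function on the Lie algebra, whose first
order Taylor expansion at the origin is computed here. -/
lemma exists_hasFDerivAt_integral_wignerIntegrand (h𝒪 : IsWeaklyExponential m 𝒪) {f : G → ℂ}
    (hf : ContMDiff 𝓘(ℝ, E) 𝓘(ℝ, ℂ) ∞ f) (φ ψ : testFunctions E G) :
    ∃ L : E →L[ℝ] ℂ,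
      HasFDerivAt (fun X => ∫ q, wignerIntegrand 𝒪 f φ ψ (q, X) ∂m) L 0 ∧
      (∫ q, wignerIntegrand 𝒪 f φ ψ (q, 0) ∂m =
        ∫ q, (starRingEnd ℂ) ((φ : G → ℂ) q) * (f q * (ψ : G → ℂ) q) ∂m) ∧
      ∀ Y, L Y = ∫ q, (1 / 2 : ℂ) * (f q * ((starRingEnd ℂ) (leftFDeriv (φ : G → ℂ) q Y) *
        (ψ : G → ℂ) q - (starRingEnd ℂ) ((φ : G → ℂ) q) * leftFDeriv (ψ : G → ℂ) q Y)) ∂m := by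
  have := FiniteDimensional.proper ℝ E
  obtain ⟨K, hK, B, -, hKB⟩ := exists_isCompact_of_wignerKernel_ne_zero h𝒪 φ.2.2 ψ.2.2
  obtain ⟨r, hr, hr𝒪⟩ := Metric.nhds_basis_closedBall.mem_iff.1 (h𝒪.isOpen.mem_nhds h𝒪.zero_mem)
  obtain ⟨L, hL, hLY⟩ := exists_hasFDerivAt_integral (E := E) m (Φ := wignerKernel f φ ψ) hr
    (fun X hX q => contMDiffAt_wignerKernel h𝒪 hf φ.2.1 ψ.2.1 (hr𝒪 hX) q) hK
    (fun X hX q hq => by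
      by_contra h
      exact hq (hKB f X (hr𝒪 hX) q h).1)
  have heq : ∀ X ∈ 𝒪, ∫ q, wignerIntegrand 𝒪 f φ ψ (q, X) ∂m =
      (∫ q, wignerKernel f φ ψ X q ∂m) * (jacF G X : ℂ) := fun X hX => by
    rw [← integral_mul_const]
    refine integral_congr_ae (Filter.Eventually.of_forall fun q => ?_)
    exact Set.indicator_of_mem (show (q, X) ∈ (Set.univ : Set G) ×ˢ 𝒪 from ⟨trivial, hX⟩) _
  obtain ⟨hF0, hF⟩ := jacF_zero_and_hasFDerivAt (E := E) G
  refine ⟨L, ?_, ?_, fun Y => ?_⟩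
  · have h := hF.smul hL
    rw [hF0, one_smul, ContinuousLinearMap.zero_smulRight, add_zero] at h
    refine h.congr_of_eventuallyEq ((h𝒪.isOpen.eventually_mem h𝒪.zero_mem).mono fun X hX => ?_)
    exact (heq X hX).trans ((mul_comm _ _).trans (Complex.real_smul).symm)
  · rw [heq 0 h𝒪.zero_mem, hF0, Complex.ofReal_one, mul_one]
    refine integral_congr_ae (Filter.Eventually.of_forall fun q => ?_)
    simp only [wignerKernel, smul_zero, lieExp_zero, mul_one]
    ring
  · rw [hLY]
    exact integral_congr_ae (Filter.Eventually.of_forall fun q =>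
      fderiv_wignerKernel h𝒪 φ.2.1 ψ.2.1 q Y)

end Integrand

/-! ### Evaluation of the improper integrals -/

section Improper

variable {E : Type*} [NormedAddCommGroup E] [NormedSpace ℝ E] [FiniteDimensional ℝ E]
variable [MeasurableSpace E] [BorelSpace E]
variable {G : Type*} [TopologicalSpace G] [ChartedSpace E G] [Group G] [LieGroup 𝓘(ℝ, E) ∞ G]
variable [T2Space G] [SecondCountableTopology G] [MeasurableSpace G] [BorelSpace G]
variable {m : Measure G} [SFinite m] [IsFiniteMeasureOnCompacts m]
variable {dX : Measure E} [dX.IsAddHaarMeasure] {dp : Measure (StrongDual ℝ E)}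
  [dp.IsAddHaarMeasure] {𝒪 : Set E} {ħ : ℝ}

lemma hasImproperIntegral_mul_wigner (hdp : IsFourierDual dX dp) (h𝒪 : IsWeaklyExponential m 𝒪)
    (hħ : ħ ≠ 0) {f : G → ℂ} (hf : ContMDiff 𝓘(ℝ, E) 𝓘(ℝ, ℂ) ∞ f) (φ ψ : testFunctions E G) :
    HasImproperIntegral m dp (fun x => f x.1 * wigner ħ dX 𝒪 φ ψ x)
      ((|2 * Real.pi * ħ| ^ Module.finrank ℝ E : ℝ) *
        ∫ q, (starRingEnd ℂ) ((φ : G → ℂ) q) * (f q * (ψ : G → ℂ) q) ∂m) := by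
  intro χ hχ hχc hχ0
  have := FiniteDimensional.proper ℝ E
  have := FiniteDimensional.proper ℝ (StrongDual ℝ E)
  obtain ⟨K, B, M, hJ, -⟩ := exists_isTameIntegrand h𝒪 hf φ ψ
  obtain ⟨L, hL, h0, -⟩ := exists_hasFDerivAt_integral_wignerIntegrand (m := m) h𝒪 hf φ ψ
  have key := fun (ε : ℝ) (hε : 0 < ε) => integral_mul_fourier_prod m dX dp hJ.measurable
    hJ.isCompact_left hJ.isCompact_right hJ.eq_zero_left hJ.eq_zero_right hJ.norm_le
    (u := fun p => (χ (ε • p) : ℂ)) (by have := hχ.continuous; fun_prop)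
    ((hχc.comp_smul hε.ne').comp_left Complex.ofReal_zero) ħ
  simp only [mul_wigner_eq ħ dX h𝒪.isOpen]
  refine ⟨fun ε hε => (key ε hε).1, ?_⟩
  have h := tendsto_integral_mul_dualFourier dX dp hdp (u := fun p => (χ p : ℂ))
    (Complex.ofRealCLM.contDiff.comp hχ) (hχc.comp_left Complex.ofReal_zero)
    (hJ.measurable.stronglyMeasurable.integral_prod_left' (μ := m)).measurable
    (norm_integral_left_le m hJ.isCompact_left hJ.eq_zero_left hJ.norm_le) hL.continuousAt hħ
  rw [h0, hχ0, Complex.ofReal_one, one_mul] at h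
  refine h.congr' ?_
  filter_upwards [self_mem_nhdsWithin] with ε hε
  exact (key ε hε).2.symm

lemma hasImproperIntegral_eval_mul_wigner (hdp : IsFourierDual dX dp)
    (h𝒪 : IsWeaklyExponential m 𝒪) (hħ : ħ ≠ 0) (X₀ : E) (φ ψ : testFunctions E G) :
    HasImproperIntegral m dp (fun x => ((x.2 X₀ : ℝ) : ℂ) * wigner ħ dX 𝒪 φ ψ x)
      ((|2 * Real.pi * ħ| ^ Module.finrank ℝ E : ℝ) * (-Complex.I * ħ *
        ∫ q, (1 / 2 : ℂ) * ((starRingEnd ℂ) (leftFDeriv (φ : G → ℂ) q X₀) * (ψ : G → ℂ) q -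
          (starRingEnd ℂ) ((φ : G → ℂ) q) * leftFDeriv (ψ : G → ℂ) q X₀) ∂m)) := by
  intro χ hχ hχc hχ0
  have := FiniteDimensional.proper ℝ E
  have := FiniteDimensional.proper ℝ (StrongDual ℝ E)
  have hf : ContMDiff 𝓘(ℝ, E) 𝓘(ℝ, ℂ) ∞ (fun _ : G => (1 : ℂ)) := contMDiff_const
  obtain ⟨K, B, M, hJ, -⟩ := exists_isTameIntegrand h𝒪 hf φ ψ
  obtain ⟨L, hL, -, hLY⟩ := exists_hasFDerivAt_integral_wignerIntegrand (m := m) h𝒪 hf φ ψ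
  -- With this u one has χ(εp)⟨p, X₀⟩ = ε⁻¹ u(εp): the unbounded symbol is absorbed into a cut-off
  -- vanishing at 0.
  set u : StrongDual ℝ E → ℂ := fun p => (χ p : ℂ) * (p X₀ : ℂ) with hu
  have huc : HasCompactSupport u := (hχc.comp_left Complex.ofReal_zero).mul_right
  have hev : ContDiff ℝ ∞ (fun p : StrongDual ℝ E => p X₀) := by fun_prop
  have hus : ContDiff ℝ ∞ u :=
    (Complex.ofRealCLM.contDiff.comp hχ).mul (Complex.ofRealCLM.contDiff.comp hev)
  have hdu : ∀ ℓ, fderiv ℝ u 0 ℓ = (ℓ X₀ : ℂ) := fun ℓ => by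
    have h1 : HasFDerivAt (fun p : StrongDual ℝ E => (χ p : ℂ)) _ 0 :=
      Complex.ofRealCLM.hasFDerivAt.comp (0 : StrongDual ℝ E)
        (hχ.differentiable (by simp) 0).hasFDerivAt
    have h2 : HasFDerivAt (fun p : StrongDual ℝ E => (p X₀ : ℂ)) _ 0 :=
      (Complex.ofRealCLM.comp (ContinuousLinearMap.apply ℝ ℝ X₀)).hasFDerivAt
    have h3 : HasFDerivAt u _ 0 := h1.mul h2
    rw [h3.fderiv]
    simp [hχ0]
  have key := fun (ε : ℝ) (hε : 0 < ε) => integral_mul_fourier_prod m dX dp hJ.measurable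
    hJ.isCompact_left hJ.isCompact_right hJ.eq_zero_left hJ.eq_zero_right hJ.norm_le
    (u := fun p => u (ε • p)) (by have := hus.continuous; fun_prop) (huc.comp_smul hε.ne') ħ
  have hw : ∀ ε : ℝ, 0 < ε → (fun x : G × StrongDual ℝ E =>
      (χ (ε • x.2) : ℂ) * (((x.2 X₀ : ℝ) : ℂ) * wigner ħ dX 𝒪 φ ψ x)) = fun x =>
      (ε : ℂ)⁻¹ * (u (ε • x.2) * ∫ X, wignerIntegrand 𝒪 (fun _ => 1) φ ψ (x.1, X) *
        Complex.exp (-(Complex.I / (ħ : ℂ)) * (x.2 X : ℂ)) ∂dX) := fun ε hε => by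
    funext x
    have hε' : (ε : ℂ) ≠ 0 := Complex.ofReal_ne_zero.2 hε.ne'
    rw [← mul_wigner_eq ħ dX h𝒪.isOpen, hu]
    simp only [smul_apply, smul_eq_mul, Complex.ofReal_mul]
    field_simp
  refine ⟨fun ε hε => ?_, ?_⟩
  · rw [hw ε hε]
    exact (key ε hε).1.const_mul _
  have h := tendsto_inv_mul_integral_mul_dualFourier dX dp hdp hus huc (by simp [hu]) hdu
    (hJ.measurable.stronglyMeasurable.integral_prod_left' (μ := m)).measurable
    (norm_integral_left_le m hJ.isCompact_left hJ.eq_zero_left hJ.norm_le) hL hħ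
  rw [hLY] at h
  simp only [one_mul] at h
  refine h.congr' ?_
  filter_upwards [self_mem_nhdsWithin] with ε hε
  rw [hw ε hε, integral_const_mul, (key ε hε).2]

end Improper

/-! ### Test functions in L² -/

section TestFunctionOperators

variable {E : Type*} [NormedAddCommGroup E] [NormedSpace ℝ E]
variable {G : Type*} [TopologicalSpace G] [ChartedSpace E G]

/-- The inclusion of the test functions in `L²(G, m)` as a linear map. -/
def toL2Linear [MeasurableSpace G] [BorelSpace G] (m : Measure G)
    [IsFiniteMeasureOnCompacts m] : testFunctions E G →ₗ[ℂ] Lp ℂ 2 m where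
  toFun := toL2 m
  map_add' _ _ := MemLp.toLp_add _ _
  map_smul' _ _ := MemLp.toLp_const_smul _ _

/-- Multiplication of test functions by a smooth function. -/
def mulTestFunction (f : G → ℂ) (hf : ContMDiff 𝓘(ℝ, E) 𝓘(ℝ, ℂ) ∞ f) :
    testFunctions E G →ₗ[ℂ] testFunctions E G where
  toFun ψ := ⟨fun q => f q * (ψ : G → ℂ) q, by
    have hm : ContDiff ℝ ∞ (fun p : ℂ × ℂ => p.1 * p.2) := contDiff_fst.mul contDiff_snd
    exact hm.contMDiff.comp (hf.prodMk_space ψ.2.1), ψ.2.2.mul_left⟩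
  map_add' _ _ := Subtype.ext (funext fun _ => mul_add _ _ _)
  map_smul' _ _ := Subtype.ext (funext fun _ => mul_left_comm _ _ _)

/-- The derivative of test functions along a left-invariant vector field. -/
def derivTestFunction [Group G] [LieGroup 𝓘(ℝ, E) ∞ G] (X : E) :
    testFunctions E G →ₗ[ℂ] testFunctions E G where
  toFun ψ := ⟨fun q => leftFDeriv (ψ : G → ℂ) q X,
    (ContinuousLinearMap.apply ℝ ℂ X).contMDiff.comp (contMDiff_leftFDeriv ψ.2.1),
    (hasCompactSupport_leftFDeriv ψ.2.1 ψ.2.2).comp_left (g := fun A : E →L[ℝ] ℂ => A X)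
      (zero_apply X)⟩
  map_add' φ ψ := Subtype.ext (funext fun q => by
    have h := (hasFDerivAt_mul_unitChart φ.2.1 q).add (hasFDerivAt_mul_unitChart ψ.2.1 q)
    exact DFunLike.congr_fun ((hasFDerivAt_mul_unitChart (φ + ψ).2.1 q).unique h) X)
  map_smul' c ψ := Subtype.ext (funext fun q =>
    leftFDeriv_clm_comp (c • ContinuousLinearMap.id ℝ ℂ) ψ.2.1 q X)

variable [MeasurableSpace G] [BorelSpace G] {m : Measure G} [IsFiniteMeasureOnCompacts m]

lemma inner_toL2 (φ : testFunctions E G) (v : Lp ℂ 2 m) :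
    inner ℂ (toL2 m φ) v = ∫ q, (starRingEnd ℂ) ((φ : G → ℂ) q) * v q ∂m := by
  rw [L2.inner_def]
  refine integral_congr_ae ?_
  filter_upwards [(memLp_testFunction m φ).coeFn_toLp] with q hq
  rw [RCLike.inner_apply, mul_comm, toL2, hq]

lemma inner_toL2_toL2 (φ ψ : testFunctions E G) : inner ℂ (toL2 m φ) (toL2 m ψ) =
    ∫ q, (starRingEnd ℂ) ((φ : G → ℂ) q) * (ψ : G → ℂ) q ∂m := by
  rw [inner_toL2]
  refine integral_congr_ae ?_
  filter_upwards [(memLp_testFunction m ψ).coeFn_toLp] with q hq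
  rw [toL2, hq]

lemma integrable_conj_mul (φ ψ : testFunctions E G) :
    Integrable (fun q => (starRingEnd ℂ) ((φ : G → ℂ) q) * (ψ : G → ℂ) q) m :=
  ((Complex.continuous_conj.comp φ.2.1.continuous).mul
    ψ.2.1.continuous).integrable_of_hasCompactSupport ψ.2.2.mul_left

/-- The test functions are dense in `L²(G, m)`. -/
lemma eq_of_forall_inner_toL2_eq [FiniteDimensional ℝ E] [IsManifold 𝓘(ℝ, E) ∞ G] [T2Space G]
    [SecondCountableTopology G] {v w : Lp ℂ 2 m}
    (h : ∀ φ : testFunctions E G, inner ℂ (toL2 m φ) v = inner ℂ (toL2 m φ) w) : v = w := by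
  have : LocallyCompactSpace G := Manifold.locallyCompact_of_finiteDimensional 𝓘(ℝ, E)
  rw [← sub_eq_zero]
  refine (Lp.eq_zero_iff_ae_eq_zero).2 ?_
  refine ae_eq_zero_of_integral_contMDiff_smul_eq_zero 𝓘(ℝ, E)
    ((Lp.memLp (v - w)).locallyIntegrable (by norm_num)) fun g hg hgc => ?_
  -- A real-valued test function, so the conjugation in the scalar product disappears.
  let φ : testFunctions E G := ⟨fun q => (g q : ℂ), Complex.ofRealCLM.contMDiff.comp hg,
    hgc.comp_left Complex.ofReal_zero⟩
  have h1 : inner ℂ (toL2 m φ) (v - w) = 0 := by rw [inner_sub_right, h φ, sub_self]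
  rw [inner_toL2] at h1
  refine Eq.trans (integral_congr_ae (Filter.Eventually.of_forall fun q => ?_)) h1
  simp [φ]

end TestFunctionOperators

/-! ### Operators determined by their matrix elements -/

section Operators

variable {E : Type*} [NormedAddCommGroup E] [NormedSpace ℝ E] [FiniteDimensional ℝ E]
variable {G : Type*} [MeasurableSpace G]

omit [FiniteDimensional ℝ E] in
-- A bump function shows that admissible cut-offs exist; one of them already determines the limit.
lemma HasImproperIntegral.unique [FiniteDimensional ℝ E] {m : Measure G}
    {dp : Measure (StrongDual ℝ E)} {Φ : G × StrongDual ℝ E → ℂ} {c d : ℂ}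
    (hc : HasImproperIntegral m dp Φ c) (hd : HasImproperIntegral m dp Φ d) : c = d := by
  let b : ContDiffBump (0 : StrongDual ℝ E) := ⟨1, 2, one_pos, one_lt_two⟩
  have hb : b 0 = 1 := b.one_of_mem_closedBall (Metric.mem_closedBall_self b.rIn_pos.le)
  exact tendsto_nhds_unique (hc b b.contDiff b.hasCompactSupport hb).2
    (hd b b.contDiff b.hasCompactSupport hb).2

variable [MeasurableSpace E] [BorelSpace E]
variable [TopologicalSpace G] [ChartedSpace E G] [Group G] [LieGroup 𝓘(ℝ, E) ∞ G]
variable [T2Space G] [SecondCountableTopology G] [BorelSpace G]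

omit [BorelSpace E] in
/-- An operator given by a quadratic form on test functions exists and is unique. -/
lemma isOperatorOf_toL2Linear_comp {m : Measure G} [IsFiniteMeasureOnCompacts m] {dX : Measure E}
    {dp : Measure (StrongDual ℝ E)} {𝒪 : Set E} {ħ : ℝ} (hħ : ħ ≠ 0)
    {f : G × StrongDual ℝ E → ℂ} (T : testFunctions E G →ₗ[ℂ] testFunctions E G)
    (hT : ∀ φ ψ : testFunctions E G,
      HasImproperIntegral m dp (fun x => f x * wigner ħ dX 𝒪 φ ψ x)
        ((|2 * Real.pi * ħ| ^ Module.finrank ℝ E : ℝ) *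
          ∫ q, (starRingEnd ℂ) ((φ : G → ℂ) q) * (T ψ : G → ℂ) q ∂m)) :
    IsOperatorOf ħ m dX dp 𝒪 f (toL2Linear m ∘ₗ T) ∧
      ∀ B : testFunctions E G →ₗ[ℂ] Lp ℂ 2 m, IsOperatorOf ħ m dX dp 𝒪 f B →
        B = toL2Linear m ∘ₗ T := by
  have hne : ((|2 * Real.pi * ħ| ^ Module.finrank ℝ E : ℝ) : ℂ) ≠ 0 :=
    Complex.ofReal_ne_zero.2 (pow_ne_zero _ (abs_ne_zero.2
      (mul_ne_zero (mul_ne_zero two_ne_zero Real.pi_ne_zero) hħ)))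
  have hinner : ∀ φ ψ : testFunctions E G, inner ℂ (toL2 m φ) ((toL2Linear m ∘ₗ T) ψ) =
      (1 / |2 * Real.pi * ħ| ^ Module.finrank ℝ E : ℝ) *
        ((|2 * Real.pi * ħ| ^ Module.finrank ℝ E : ℝ) *
          ∫ q, (starRingEnd ℂ) ((φ : G → ℂ) q) * (T ψ : G → ℂ) q ∂m) := fun φ ψ => by
    rw [Complex.ofReal_div, Complex.ofReal_one, ← mul_assoc, one_div_mul_cancel hne, one_mul]
    exact inner_toL2_toL2 φ (T ψ)
  refine ⟨fun φ ψ => ⟨_, hT φ ψ, hinner φ ψ⟩, fun B hB => LinearMap.ext fun ψ => ?_⟩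
  refine eq_of_forall_inner_toL2_eq (E := E) fun φ => ?_
  obtain ⟨c, hc, hBc⟩ := hB φ ψ
  rw [hBc, hinner, hc.unique (hT φ ψ)]

/-- The operator `iħ (L_X - ½ tr ad_X)` on test functions. -/
def momentum (ħ : ℝ) (X : E) : testFunctions E G →ₗ[ℂ] testFunctions E G :=
  (Complex.I * (ħ : ℂ)) • (derivTestFunction X -
    ((1 / 2 : ℂ) * ((LinearMap.trace ℝ E (ad G X) : ℝ) : ℂ)) • LinearMap.id)

omit [MeasurableSpace E] [BorelSpace E] in
-- The divergence formula for conj φ · ψ reads ∫ conj(L_X φ) ψ + ∫ conj φ L_X ψ = tr(ad_X) ∫ conj φ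
-- ψ. Eliminating the first integral from the symmetrized expression leaves L_X - ½ tr ad_X acting
-- on ψ.
lemma integral_conj_mul_momentum (m : Measure G) [m.IsHaarMeasure] (ħ : ℝ) (X : E)
    (φ ψ : testFunctions E G) :
    ∫ q, (starRingEnd ℂ) ((φ : G → ℂ) q) * (momentum ħ X ψ : G → ℂ) q ∂m =
      -Complex.I * ħ * ∫ q, (1 / 2 : ℂ) *
        ((starRingEnd ℂ) (leftFDeriv (φ : G → ℂ) q X) * (ψ : G → ℂ) q -
          (starRingEnd ℂ) ((φ : G → ℂ) q) * leftFDeriv (ψ : G → ℂ) q X) ∂m := by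
  set c : ℝ := LinearMap.trace ℝ E (ad G X) with hc
  have i1 := integrable_conj_mul (m := m) (derivTestFunction X φ) ψ
  have i2 := integrable_conj_mul (m := m) φ (derivTestFunction X ψ)
  have i3 := integrable_conj_mul (m := m) φ ψ
  have hconj : ContMDiff 𝓘(ℝ, E) 𝓘(ℝ, ℂ) ∞ (fun q => (starRingEnd ℂ) ((φ : G → ℂ) q)) :=
    Complex.conjCLE.contDiff.contMDiff.comp φ.2.1
  have hm := integral_leftFDeriv_eq_trace_ad m (mulTestFunction _ hconj ψ).2.1
    (mulTestFunction _ hconj ψ).2.2 X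
  have hd : ∀ q, leftFDeriv (mulTestFunction _ hconj ψ : G → ℂ) q X =
      (starRingEnd ℂ) ((derivTestFunction X φ : G → ℂ) q) * (ψ : G → ℂ) q +
        (starRingEnd ℂ) ((φ : G → ℂ) q) * (derivTestFunction X ψ : G → ℂ) q := fun q => by
    refine (leftFDeriv_mul hconj ψ.2.1 q X).trans ?_
    congr 2
    exact leftFDeriv_clm_comp Complex.conjCLE.toContinuousLinearMap φ.2.1 q X
  simp only [hd] at hm
  rw [integral_add i1 i2, ← hc, Complex.real_smul] at hm
  have hl : ∀ q, (starRingEnd ℂ) ((φ : G → ℂ) q) * (momentum ħ X ψ : G → ℂ) q =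
      Complex.I * ħ * ((starRingEnd ℂ) ((φ : G → ℂ) q) * (derivTestFunction X ψ : G → ℂ) q -
        (1 / 2 * (c : ℂ)) * ((starRingEnd ℂ) ((φ : G → ℂ) q) * (ψ : G → ℂ) q)) := fun q => by
    have h : (momentum ħ X ψ : G → ℂ) q = Complex.I * ħ * ((derivTestFunction X ψ : G → ℂ) q -
      (1 / 2 * (c : ℂ)) * (ψ : G → ℂ) q) := rfl
    rw [h]
    ring
  simp only [hl]
  rw [integral_const_mul, integral_const_mul, integral_sub i2 (i3.const_mul _),
    integral_const_mul]
  refine Eq.trans ?_ (congrArg (fun z => -Complex.I * ħ * ((1 / 2 : ℂ) * z))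
    (integral_sub i1 i2).symm)
  have hm' : (c : ℂ) * ∫ q, (starRingEnd ℂ) ((φ : G → ℂ) q) * (ψ : G → ℂ) q ∂m = _ := hm.symm
  rw [mul_assoc (1 / 2 : ℂ), hm']
  ring

end Operators

end LieQuant

end

/-! ### The operators of the fiber variables and of functions on the group -/

theorem mainTheorem12
    {E : Type*} [NormedAddCommGroup E] [NormedSpace ℝ E] [FiniteDimensional ℝ E]
    [MeasurableSpace E] [BorelSpace E]
    {G : Type*} [TopologicalSpace G] [ChartedSpace E G] [Group G] [LieGroup 𝓘(ℝ, E) ∞ G]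
    [T2Space G] [SecondCountableTopology G] [MeasurableSpace G] [BorelSpace G]
    (m : Measure G) [m.IsHaarMeasure]
    (dX : Measure E) [dX.IsAddHaarMeasure]
    (dp : Measure (StrongDual ℝ E)) [dp.IsAddHaarMeasure]
    (hdp : LieQuant.IsFourierDual dX dp)
    (𝒪 : Set E) (h𝒪 : LieQuant.IsWeaklyExponential m 𝒪)
    (ħ : ℝ) (hħ : ħ ≠ 0) :
    (∀ {n : ℕ} (X : Module.Basis (Fin n) ℝ E) (j : Fin n),
      ∃ P : LieQuant.testFunctions E G →ₗ[ℂ] Lp ℂ 2 m,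
        LieQuant.IsOperatorOf ħ m dX dp 𝒪 (fun x => ((x.2 (X j) : ℝ) : ℂ)) P ∧
        (∀ B : LieQuant.testFunctions E G →ₗ[ℂ] Lp ℂ 2 m,
          LieQuant.IsOperatorOf ħ m dX dp 𝒪 (fun x => ((x.2 (X j) : ℝ) : ℂ)) B → B = P) ∧
        (∀ ψ : LieQuant.testFunctions E G, P ψ =ᵐ[m] fun q =>
          Complex.I * (ħ : ℂ) * (LieQuant.lieDeriv (X j) ψ q -
            (1 / 2 : ℂ) * ((∑ k, LieQuant.structureConst G X k j k : ℝ) : ℂ) *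
              (ψ : G → ℂ) q)) ∧
        (m.IsMulRightInvariant → ∀ ψ : LieQuant.testFunctions E G, P ψ =ᵐ[m] fun q =>
          Complex.I * (ħ : ℂ) * LieQuant.lieDeriv (X j) ψ q)) ∧
    (∀ f : G → ℂ, ContMDiff 𝓘(ℝ, E) 𝓘(ℝ, ℂ) ∞ f →
      ∃ A : LieQuant.testFunctions E G →ₗ[ℂ] Lp ℂ 2 m,
        LieQuant.IsOperatorOf ħ m dX dp 𝒪 (fun x => f x.1) A ∧
        (∀ B : LieQuant.testFunctions E G →ₗ[ℂ] Lp ℂ 2 m,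
          LieQuant.IsOperatorOf ħ m dX dp 𝒪 (fun x => f x.1) B → B = A) ∧
        (∀ ψ : LieQuant.testFunctions E G, A ψ =ᵐ[m] fun q => f q * (ψ : G → ℂ) q)) := by
  -- Together with second countability this makes `m` σ-finite, as Fubini's theorem requires.
  have hLC : LocallyCompactSpace G := Manifold.locallyCompact_of_finiteDimensional 𝓘(ℝ, E)
  refine ⟨fun {n} X j => ?_, fun f hf => ?_⟩
  · obtain ⟨h1, h2⟩ := LieQuant.isOperatorOf_toL2Linear_comp (m := m) (dX := dX) (dp := dp)
      (𝒪 := 𝒪) hħ (f := fun x => ((x.2 (X j) : ℝ) : ℂ)) (LieQuant.momentum ħ (X j))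
      fun φ ψ => by
        rw [LieQuant.integral_conj_mul_momentum]
        exact LieQuant.hasImproperIntegral_eval_mul_wigner hdp h𝒪 hħ (X j) φ ψ
    have h3 : ∀ ψ : LieQuant.testFunctions E G,
        (LieQuant.toL2Linear m ∘ₗ LieQuant.momentum ħ (X j)) ψ =ᵐ[m] fun q =>
          Complex.I * (ħ : ℂ) * (LieQuant.lieDeriv (X j) ψ q - (1 / 2 : ℂ) *
            ((LinearMap.trace ℝ E (LieQuant.ad G (X j)) : ℝ) : ℂ) * (ψ : G → ℂ) q) := fun ψ => by
      filter_upwards [(LieQuant.memLp_testFunction m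
        (LieQuant.momentum ħ (X j) ψ)).coeFn_toLp] with q hq
      rw [LieQuant.lieDeriv_eq_leftFDeriv ψ.2.1]
      exact hq
    refine ⟨_, h1, h2, fun ψ => ?_, fun hm ψ => ?_⟩
    · rw [← LieQuant.trace_ad_eq_sum_structureConst]
      exact h3 ψ
    · have h4 := h3 ψ
      rw [LieQuant.trace_ad_eq_zero_of_isMulRightInvariant m] at h4
      simpa only [Complex.ofReal_zero, mul_zero, zero_mul, sub_zero] using h4
  · obtain ⟨h1, h2⟩ := LieQuant.isOperatorOf_toL2Linear_comp (m := m) (dX := dX) (dp := dp)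
      (𝒪 := 𝒪) hħ (f := fun x => f x.1) (LieQuant.mulTestFunction f hf)
      fun φ ψ => LieQuant.hasImproperIntegral_mul_wigner hdp h𝒪 hħ hf φ ψ
    exact ⟨_, h1, h2, fun ψ =>
      (LieQuant.memLp_testFunction m (LieQuant.mulTestFunction f hf ψ)).coeFn_toLp⟩
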